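/- An \emph{$\alpha$-sequence} is a nonempty finite sequence $\alpha=(\alpha_1,\dots,\alpha_k)$ of positive integers; its length is $k$ and its degree is $D(\alpha)=\alpha_1+\dots+\alpha_k$. Products of sequences are concatenations. Put $Al(\alpha)=(\alpha_1,-\alpha_2,\dots,(-1)^{k-1}\alpha_k,0,0,\dots)$, and write $\alpha<\beta$ (and call $\beta$ a \emph{successor} of $\alpha$) if the first nonzero term of $Al(\alpha)-Al(\beta)$ is negative. A sequence $\alpha$ is \emph{lexical} if $\alpha>(\alpha_i,\dots,\alpha_k)$ for all $2\le i\le k$. Let $L_n$ be the set of lexical sequences with $1+D(\alpha)=n$, where by convention the sequence $(0)$ is admitted as well, so that $L_1=\{(0)\}$. We say that $\alpha$ is \emph{adjacent to} $\beta$ in $L_n$ if $\alpha,\beta\in L_n$, $\alpha<\beta$ and there is no $\gamma\in L_n$ with $\alpha<\gamma<\beta$. For $\alpha=(\alpha_1,\dots,\alpha_k)$ let $\alpha_e=(\alpha_1,\dots,\alpha_k+1)$ and $\alpha_o=(\alpha_1,\dots,\alpha_k,1)$ if $k$ is even, and $\alpha_e=(\alpha_1,\dots,\alpha_k,1)$ and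 $\alpha_o=(\alpha_1,\dots,\alpha_k+1)$ if $k$ is odd. The star product with $\beta=(\beta_1,\dots,\beta_l)$ is $$\alpha\star\beta=\alpha_o(\alpha_e)^{\beta_1-1}\alpha_o(\alpha_e)^{\beta_2-1}\cdots\alpha_o(\alpha_e)^{\beta_l-1}\alpha .$$ If $\alpha\ne\beta$ first differ at place $i$, then $\alpha\wedge\beta=(\alpha_1,\dots,\alpha_{i-1},\min(\alpha_i,\beta_i))$; also $\alpha\wedge\alpha=\alpha$. For even $i\le k$, the \emph{elementary operation} on the tail $\alpha_i$ of the left sequence $(\alpha_1,\dots,\alpha_i)$ of $\alpha$ produces $$(\alpha_1,\dots,\alpha_{i-1},\alpha_i-1,1,\alpha_{i+1},\dots,\alpha_k)\ \text{ if }\alpha_i>1\ (\text{splitting}),\qquad (\alpha_1,\dots,\alpha_{i-2},\alpha_{i-1}+1,\alpha_{i+1},\dots,\alpha_k)\ \text{ if }\alpha_i=1\ (\text{conjugation}).$$ \textbf{Theorem.} Let $\alpha\in L_n$ be not maximal in $L_n$. Then there is an even $i\le k$ for which the elementary operation on the tail of $(\alpha_1,\dots,\alpha_i)$ gives a successor of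 $\alpha$ lying in $L_n$. Let $\alpha'\in L_n$ be the sequence obtained for the largest such $i$, and let $f=\alpha\wedge\alpha'$. Then $f\in L_m$ for some $m$. Write $n=md+r$ with $0\le r<m$. 1. If $r>0$, then $\alpha$ is adjacent to $\alpha'$ in $L_n$. 2. If $r=0$, then $L_d$ has a least element $\lambda$, and $\alpha$ is adjacent to $f\star\lambda$ in $L_n$. -/

import Mathlib

namespace LexSeq

/-- A positive sequence (an `α`-sequence): a nonempty finite sequence of natural numbers `≥ 1`. -/
def IsPositive (α : List ℕ) : Prop :=
  α ≠ [] ∧ ∀ a ∈ α, 0 < a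

/-- The alternating sequence `Al(α) = (α₁, -α₂, α₃, -α₄, …, 0, 0, …)`. The index `i` starts
at `0` here, so that the entry at `i` is `(-1)^i α_{i+1}`, and it is `0` beyond the end of `α`. -/
def alt (α : List ℕ) (i : ℕ) : ℤ :=
  (-1) ^ i * (α.getD i 0 : ℤ)

/-- The order `α < β` on sequences: the first nonzero term of `Al(α) - Al(β)` is negative. -/
def SeqLT (α β : List ℕ) : Prop :=
  ∃ i, (∀ j < i, alt α j - alt β j = 0) ∧ alt α i - alt β i < 0

/-- `α` is lexical: `α` is greater than each of its right sequences `(α_i, …, α_k)`, `2 ≤ i ≤ k`. -/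
def IsLexical (α : List ℕ) : Prop :=
  ∀ i, 1 ≤ i → i < α.length → SeqLT (α.drop i) α

/-- The degree: the sum of the entries. -/
def degree (α : List ℕ) : ℕ := α.sum

/-- `L n`: the lexical sequences `α` with `1 + D(α) = n`. Beside the positive sequences there is
the conventional sequence `(0)`, which is the only element of `L 1`. -/
def L (n : ℕ) : Set (List ℕ) :=
  {α | (IsPositive α ∨ α = [0]) ∧ IsLexical α ∧ 1 + degree α = n}

/-- `α` is adjacent to `β` in `S`: both lie in `S`, `α < β`, and no element of `S` lies strictly
between them. -/
def IsAdjacentTo (S : Set (List ℕ)) (α β : List ℕ) : Prop :=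
  α ∈ S ∧ β ∈ S ∧ SeqLT α β ∧ ¬ ∃ γ ∈ S, SeqLT α γ ∧ SeqLT γ β

/-- `α` is the maximal element of `S`. -/
def IsMaximalIn (S : Set (List ℕ)) (α : List ℕ) : Prop :=
  α ∈ S ∧ ∀ β ∈ S, β = α ∨ SeqLT β α

/-- `α` is the least element of `S`. -/
def IsLeastIn (S : Set (List ℕ)) (α : List ℕ) : Prop :=
  α ∈ S ∧ ∀ β ∈ S, β = α ∨ SeqLT α β

/-- `α ∧ β`: if the sequences first differ at place `i`, this is
`(α₁, …, α_{i-1}, min(α_i, β_i))`; moreover `α ∧ α = α`. -/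
def wedge : List ℕ → List ℕ → List ℕ
  | [], _ => []
  | _ :: _, [] => []
  | a :: α, b :: β => if a = b then a :: wedge α β else [min a b]

/-- Add `1` to the last entry: `(α₁, …, α_k) ↦ (α₁, …, α_k + 1)`. -/
def incrLast : List ℕ → List ℕ
  | [] => []
  | [a] => [a + 1]
  | a :: b :: α => a :: incrLast (b :: α)

/-- `α_e`, of even length. -/
def evenExt (α : List ℕ) : List ℕ :=
  if Even α.length then incrLast α else α ++ [1]

/-- `α_o`, of odd length. -/
def oddExt (α : List ℕ) : List ℕ :=
  if Even α.length then α ++ [1] else incrLast α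

/-- The star product
`α ⋆ β = α_o (α_e)^{β₁ - 1} α_o (α_e)^{β₂ - 1} ⋯ α_o (α_e)^{β_k - 1} α` of positive sequences. -/
def star (α β : List ℕ) : List ℕ :=
  (β.flatMap fun b => oddExt α ++ (List.replicate (b - 1) (evenExt α)).flatten) ++ α

/-- Splitting of the cell `i` (cells are numbered from `1`):
`(α₁, …, α_i - 1)_o (α_{i+1}, …, α_k)` for `i` even, `(α₁, …, α_i - 1)_e (α_{i+1}, …, α_k)` for
`i` odd. It is used only for `α_i > 1`. -/
def splitCell (α : List ℕ) (i : ℕ) : List ℕ :=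
  let left := α.take (i - 1) ++ [α.getD (i - 1) 0 - 1]
  (if Even i then oddExt left else evenExt left) ++ α.drop i

/-- Conjugation of the cell `i` (cells are numbered from `1`):
`(α₁, …, α_{i-1})_o (α_{i+1}, …, α_k)` for `i` even, `(α₁, …, α_{i-1})_e (α_{i+1}, …, α_k)` for
`i` odd. It is used only for `α_i = 1` and `i ≥ 2`. -/
def conjCell (α : List ℕ) (i : ℕ) : List ℕ :=
  let left := α.take (i - 1)
  (if Even i then oddExt left else evenExt left) ++ α.drop i

/-- `α'` is obtained from `α` by one elementary operation on the cell `i`, the tail of the left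
sequence `(α₁, …, α_i)`. -/
inductive ElemOp (α : List ℕ) (i : ℕ) : List ℕ → Prop
  | split (h1 : 1 ≤ i) (h2 : i ≤ α.length) (h3 : 1 < α.getD (i - 1) 0) :
      ElemOp α i (splitCell α i)
  | conj (h1 : 2 ≤ i) (h2 : i ≤ α.length) (h3 : α.getD (i - 1) 0 = 1) :
      ElemOp α i (conjCell α i)

/-- An elementary operation on the tail of the left sequence of `α` of even length `i` gives
`α'`, and `α'` is a lexical successor of `α` in `L n`. -/
def GivesLexicalSuccessor (n : ℕ) (α : List ℕ) (i : ℕ) (α' : List ℕ) : Prop :=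
  Even i ∧ ElemOp α i α' ∧ α' ∈ L n ∧ SeqLT α α'

/-- `α'` is obtained from `α` by one elementary operation on the tail of the longest left sequence
of even length which gives a lexical successor in `L n`. -/
def IsLongestLexicalStep (n : ℕ) (α α' : List ℕ) : Prop :=
  ∃ i, GivesLexicalSuccessor n α i α' ∧ ∀ j β, GivesLexicalSuccessor n α j β → j ≤ i

end LexSeq

namespace LexSeq

/-! Encode a sequence as the word `R L^{α₁-1} R L^{α₂-1} ⋯` (`enc`), and order words by the value of
the corresponding tent-map itinerary (`val`). The order on sequences becomes the order of values
(`seqLT_iff_val`), lexical means greater than every proper suffix (`isLexical_iff`), and for `n ≥ 2`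
the index `n` is the length of the word plus one, its order. Even prefixes preserve the order of
words and odd ones reverse it; words beginning with `ev g` lie below `g`, those beginning with `od
g` above.

Let `ev g ++ s < od g ++ t` be consecutive lexical words of order `n`. Their common prefix `g` is
lexical (`lex_of_common_prefix`). A lexical word between `ev g ++ s` and `g` cannot have an order
dividing `n`, since it, or a star product with it, would separate the neighbours
(`Neighbours.not_dvd`). Such words are produced by `Lex.exists_lt_dvd`, which rests on
`Lex.exists_between_dvd`, a Euclidean algorithm on orders. If the order of `g` does not divide `n`,
then `s < t` would yield a forbidden word, while `t < s` would make `od g ++ s` a lexical word in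
between; so `s = t`. If it does divide `n`, the right neighbour lies in the renormalization window
of `g`, so it is a star product with `g`, and monotonicity of the product forces the least second
factor (`Neighbours.eq_sub`).

Flipping the letter after `g` is the elementary operation, because `s` is empty or begins with `R`
(`Neighbours.ne_false_cons`). The flip is lexical even in the divisible case
(`Neighbours.lex_od_append`), and a lexical flip further to the right would lie between the
neighbours (`Neighbours.not_lex_od`). Hence this is the operation with the largest index, and its
wedge is `g`. -/

/-! ### The tent-map order on words -/

/-- The value of a word over `{R, L}` (`true` is `R`) under the itinerary map of the tent map. -/
def val : List Bool → ℚ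
  | [] => 1 / 2
  | true :: u => 1 - val u / 2
  | false :: u => val u / 2

/-- The parity of the number of letters `R`. -/
def par : List Bool → Bool
  | [] => false
  | b :: u => xor b (par u)

/-- The factor by which prefixing `w` scales values. -/
def slope : List Bool → ℚ
  | [] => 1
  | true :: u => -slope u / 2
  | false :: u => slope u / 2

/-- The extension of `g` by one letter with an even number of letters `R`. -/
def ev (g : List Bool) : List Bool := g ++ [par g]

/-- The extension of `g` by one letter with an odd number of letters `R`. -/
def od (g : List Bool) : List Bool := g ++ [!par g]

/-- A word is lexical if it is nonempty and greater than each of its proper suffixes. -/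
def Lex (w : List Bool) : Prop :=
  w ≠ [] ∧ ∀ v, v <:+ w → v ≠ w → val v < val w

@[simp] lemma val_nil : val [] = 1 / 2 := rfl
@[simp] lemma val_true (u : List Bool) : val (true :: u) = 1 - val u / 2 := rfl
@[simp] lemma val_false (u : List Bool) : val (false :: u) = val u / 2 := rfl
@[simp] lemma par_nil : par [] = false := rfl
@[simp] lemma par_cons (b : Bool) (u : List Bool) : par (b :: u) = xor b (par u) := rfl

@[simp] lemma par_append (u v : List Bool) : par (u ++ v) = xor (par u) (par v) := by
  induction u with
  | nil => simp
  | cons b u ih => simp [ih]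

@[simp] lemma par_ev (g : List Bool) : par (ev g) = false := by simp [ev]
@[simp] lemma par_od (g : List Bool) : par (od g) = true := by simp [od]
@[simp] lemma length_ev (g : List Bool) : (ev g).length = g.length + 1 := by simp [ev]
@[simp] lemma length_od (g : List Bool) : (od g).length = g.length + 1 := by simp [od]

lemma val_bounds (u : List Bool) : 0 < val u ∧ val u < 1 := by
  induction u with
  | nil => norm_num
  | cons b u ih => cases b <;> simp <;> constructor <;> linarith [ih.1, ih.2]

lemma val_pos (u : List Bool) : 0 < val u := (val_bounds u).1
lemma val_lt_one (u : List Bool) : val u < 1 := (val_bounds u).2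

lemma half_lt_val_true (u : List Bool) : 1 / 2 < val (true :: u) := by
  simp; linarith [val_lt_one u]

lemma val_false_lt_half (u : List Bool) : val (false :: u) < 1 / 2 := by
  simp; linarith [val_lt_one u]

/-- The empty word has value 1/2, words beginning with `L` lie below it and words beginning with `R`
above, so the value determines the first letter. -/
lemma val_injective : Function.Injective val := by
  intro u
  induction u with
  | nil =>
    intro v h
    rcases v with _ | ⟨_ | _, v⟩
    · rfl
    · have := val_false_lt_half v; rw [← h] at this; simp at this
    · have := half_lt_val_true v; rw [← h] at this; simp at this
  | cons b u ih =>
    intro v h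
    rcases v with _ | ⟨c, v⟩
    · cases b
      · have := val_false_lt_half u; rw [h] at this; simp at this
      · have := half_lt_val_true u; rw [h] at this; simp at this
    · have h1 := val_lt_one u
      have h2 := val_lt_one v
      cases b <;> cases c <;> simp at h
      · rw [ih h]
      · linarith
      · linarith
      · rw [ih h]

/-- Prefixing a letter applies an inverse branch of the tent map, which is affine; `slope` collects
the factors. -/
lemma val_append_sub (w u v : List Bool) :
    val (w ++ u) - val (w ++ v) = slope w * (val u - val v) := by
  induction w with
  | nil => simp [slope]
  | cons b w ih => cases b <;> simp [slope] <;> linarith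

lemma slope_even {w : List Bool} : par w = false → 0 < slope w := by
  suffices h : (par w = false → 0 < slope w) ∧ (par w = true → slope w < 0) from h.1
  induction w with
  | nil => simp [slope]
  | cons b w ih =>
    cases b <;> simp [slope]
    · exact ⟨ih.1, fun h => by linarith [ih.2 h]⟩
    · exact ⟨fun h => by linarith [ih.2 h], fun h => by linarith [ih.1 h]⟩

lemma slope_odd {w : List Bool} (h : par w = true) : slope w < 0 := by
  have := slope_even (w := true :: w) (by simp [h])
  simp [slope] at this
  linarith

lemma abs_slope_lt_one {w : List Bool} (hw : w ≠ []) : |slope w| < 1 := by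
  have key : ∀ w : List Bool, |slope w| ≤ 1 := by
    intro w
    induction w with
    | nil => simp [slope]
    | cons b w ih => cases b <;> simp [slope, abs_div] <;> linarith
  rcases w with _ | ⟨b, w⟩
  · exact absurd rfl hw
  · cases b <;> simp [slope, abs_div] <;> linarith [key w]

lemma append_lt_iff_of_even {w : List Bool} (hw : par w = false) (u v : List Bool) :
    val (w ++ u) < val (w ++ v) ↔ val u < val v := by
  have h := val_append_sub w u v
  have hs := slope_even hw
  constructor <;> intro h1 <;> nlinarith

lemma append_lt_iff_of_odd {w : List Bool} (hw : par w = true) (u v : List Bool) :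
    val (w ++ u) < val (w ++ v) ↔ val v < val u := by
  have h := val_append_sub w u v
  have hs := slope_odd hw
  constructor <;> intro h1 <;> nlinarith

lemma append_le_iff_of_even {w : List Bool} (hw : par w = false) (u v : List Bool) :
    val (w ++ u) ≤ val (w ++ v) ↔ val u ≤ val v := by
  rw [← not_lt, append_lt_iff_of_even hw, not_lt]

lemma append_le_iff_of_odd {w : List Bool} (hw : par w = true) (u v : List Bool) :
    val (w ++ u) ≤ val (w ++ v) ↔ val v ≤ val u := by
  rw [← not_lt, append_lt_iff_of_odd hw, not_lt]

/-- Prefixing a nonempty word is a contraction, so `x ↦ x - w x` is increasing. -/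
lemma append_lt_of_le {w : List Bool} (hw : w ≠ []) {u v : List Bool} (huv : val u ≤ val v)
    (h : val (w ++ u) < val u) : val (w ++ v) < val v := by
  have h1 := val_append_sub w v u
  have h2 := (abs_lt.1 (abs_slope_lt_one hw)).2
  nlinarith

/-- If `w` is odd, then `w w x < x` as soon as `w x < x`. -/
lemma append_append_lt_of_odd {w x : List Bool} (hw : par w = true)
    (h : val (w ++ x) < val x) : val (w ++ (w ++ x)) < val x := by
  have hne : w ≠ [] := by rintro rfl; simp at hw
  have h1 := val_append_sub w (w ++ x) x
  have h2 := (abs_lt.1 (abs_slope_lt_one hne)).1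
  nlinarith

/-- The appended letter is `L` when `g` preserves order and `R` when it reverses it; either way the
tail lies on the side of 1/2 that lowers the value. -/
lemma ev_append_lt (g u : List Bool) : val (ev g ++ u) < val g := by
  rw [ev, List.append_assoc]
  conv_rhs => rw [← List.append_nil g]
  cases hp : par g
  · rw [append_lt_iff_of_even hp]
    exact val_false_lt_half u
  · rw [append_lt_iff_of_odd hp]
    exact half_lt_val_true u

lemma lt_od_append (g u : List Bool) : val g < val (od g ++ u) := by
  rw [od, List.append_assoc]
  conv_lhs => rw [← List.append_nil g]
  cases hp : par g
  · rw [append_lt_iff_of_even hp]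
    exact half_lt_val_true u
  · rw [append_lt_iff_of_odd hp]
    exact val_false_lt_half u

/-- The words with a given prefix form an interval. -/
lemma prefix_of_between {p u v w : List Bool} (hu : p <+: u) (hw : p <+: w)
    (h1 : val u ≤ val v) (h2 : val v ≤ val w) : p <+: v := by
  induction p generalizing u v w with
  | nil => exact List.nil_prefix
  | cons b p ih =>
    obtain ⟨u, rfl⟩ := hu
    obtain ⟨w, rfl⟩ := hw
    simp only [List.cons_append] at h1 h2
    rcases v with _ | ⟨c, v⟩
    · exfalso
      cases b
      · have := val_false_lt_half (p ++ w)
        simp only [val_nil] at h2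
        linarith
      · have := half_lt_val_true (p ++ u)
        simp only [val_nil] at h1
        linarith
    · have a1 := val_lt_one v
      have a2 := val_lt_one (p ++ u)
      have a3 := val_lt_one (p ++ w)
      cases b <;> cases c <;> simp only [val_true, val_false] at h1 h2
      · exact List.cons_prefix_cons.2 ⟨rfl, ih (List.prefix_append p u) (List.prefix_append p w)
          (by linarith) (by linarith)⟩
      · linarith
      · linarith
      · exact List.cons_prefix_cons.2 ⟨rfl, ih (List.prefix_append p w) (List.prefix_append p u)
          (by linarith) (by linarith)⟩

/-- Words with a given prefix fill an interval, and incomparable prefixes have disjoint intervals.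
-/
lemma append_lt_append_of_not_prefix {u v : List Bool} (h : val u < val v) (h1 : ¬ u <+: v)
    (h2 : ¬ v <+: u) (a b : List Bool) : val (u ++ a) < val (v ++ b) := by
  by_contra hc
  rw [not_lt] at hc
  by_cases hv : val v ≤ val (u ++ a)
  · exact h1 (prefix_of_between List.prefix_rfl (List.prefix_append u a) h.le hv)
  · rw [not_le] at hv
    have h3 : v <+: u ++ a :=
      prefix_of_between (List.prefix_append v b) List.prefix_rfl hc hv.le
    rcases List.prefix_or_prefix_of_prefix h3 (List.prefix_append u a) with h4 | h4
    · exact h2 h4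
    · exact h1 h4

lemma eq_par_of_append_lt {g u : List Bool} {b : Bool} (h : val (g ++ b :: u) < val g) :
    b = par g := by
  by_contra hb
  have : b = !par g := by revert hb; cases b <;> cases par g <;> simp
  have h1 := lt_od_append g u
  rw [od, List.append_assoc, List.singleton_append, ← this] at h1
  linarith

lemma eq_not_par_of_lt_append {g u : List Bool} {b : Bool} (h : val g < val (g ++ b :: u)) :
    b = !par g := by
  by_contra hb
  have : b = par g := by revert hb; cases b <;> cases par g <;> simp
  have h1 := ev_append_lt g u
  rw [ev, List.append_assoc, List.singleton_append, ← this] at h1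
  linarith

lemma exists_eq_ev_append {g u : List Bool} (hg : g <+: u) (h : val u < val g) :
    ∃ s, u = ev g ++ s := by
  obtain ⟨r, rfl⟩ := hg
  rcases r with _ | ⟨b, r⟩
  · simp at h
  · exact ⟨r, by rw [ev, eq_par_of_append_lt h]; simp⟩

lemma exists_eq_od_append {g u : List Bool} (hg : g <+: u) (h : val g < val u) :
    ∃ s, u = od g ++ s := by
  obtain ⟨r, rfl⟩ := hg
  rcases r with _ | ⟨b, r⟩
  · simp at h
  · exact ⟨r, by rw [od, eq_not_par_of_lt_append h]; simp⟩

lemma suffix_append_cases {v g y : List Bool} (h : v <:+ g ++ y) :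
    v <:+ y ∨ ∃ q, q <:+ g ∧ q ≠ [] ∧ v = q ++ y := by
  obtain ⟨p, hp⟩ := h
  rcases List.append_eq_append_iff.1 hp with ⟨q, h1, h2⟩ | ⟨q, h1, h2⟩
  · by_cases hq : q = []
    · left; subst hq; simp at h2; rw [h2]
    · exact Or.inr ⟨q, ⟨p, h1.symm⟩, hq, h2⟩
  · exact Or.inl ⟨q, h2.symm⟩

/-! ### Lexical words and their borders -/

namespace Lex

lemma suffix_le {w v : List Bool} (hw : Lex w) (hv : v <:+ w) : val v ≤ val w := by
  by_cases h : v = w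
  · rw [h]
  · exact (hw.2 v hv h).le

lemma suffix_lt {w p v : List Bool} (hw : Lex w) (hp : p ≠ []) (h : w = p ++ v) :
    val v < val w :=
  hw.2 v ⟨p, h.symm⟩ (by rintro rfl; simp at h; exact hp h)

lemma half_lt {w : List Bool} (hw : Lex w) : 1 / 2 < val w := by
  have := hw.suffix_lt (p := w) (v := []) hw.1 (by simp)
  simpa using this

lemma exists_eq_cons {w : List Bool} (hw : Lex w) : ∃ u, w = true :: u := by
  have h := hw.half_lt
  rcases w with _ | ⟨_ | _, u⟩
  · simp at h
  · have := val_false_lt_half u; linarith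
  · exact ⟨u, rfl⟩

/-- A proper suffix of a lexical word `g`, followed by a letter, is an odd prefix of `g` or it lies
strictly below all the words with the prefix `g`. -/
lemma border {g p q : List Bool} (hg : Lex g) (hp : p ≠ []) (h : g = p ++ q) (b : Bool) :
    (q ++ [b] <+: g ∧ par (q ++ [b]) = true) ∨
      ∀ a c, val (q ++ b :: a) < val (g ++ c) := by
  have hlt := hg.suffix_lt hp h
  have hlen : q.length < g.length := by
    have := List.length_pos_of_ne_nil hp
    rw [h]; simp [this]
  by_cases hq : q <+: g
  · obtain ⟨r, hr⟩ := hq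
    rcases r with _ | ⟨d, r⟩
    · simp at hr; rw [hr] at hlen; exact absurd hlen (lt_irrefl _)
    · rw [← hr] at hlt
      have hd := eq_not_par_of_lt_append hlt
      by_cases hb : b = d
      · left
        refine ⟨⟨r, by rw [← hr, hb]; simp⟩, ?_⟩
        rw [hb, hd]; simp
      · right
        intro a c
        have hb' : b = par q := by revert hb hd; cases b <;> cases d <;> cases par q <;> simp
        have h1 := ev_append_lt q a
        have h2 := lt_od_append q (r ++ c)
        rw [ev, ← hb', List.append_assoc, List.singleton_append] at h1
        rw [od, ← hd, List.append_assoc, List.singleton_append] at h2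
        rw [← hr, List.append_assoc, List.cons_append]
        linarith
  · right
    intro a c
    exact append_lt_append_of_not_prefix hlt hq
      (fun h' => absurd h'.length_le (by omega)) _ _

end Lex

/-! ### Extending lexical words, and their common prefixes -/

/-- The condition on `x` under which no border of `g b` prevents `g b x` from being lexical. -/
def High (g : List Bool) (b : Bool) (x : List Bool) : Prop :=
  ∀ k z, g = k ++ z → k <:+ g ++ [b] → par k = true → val (z ++ b :: x) < val x

/-- Each inequality says that `x` minus its image under a contraction is positive, and this
difference increases with `x`. -/
lemma High.mono {g : List Bool} {b : Bool} {x y : List Bool} (h : High g b x)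
    (hxy : val x ≤ val y) : High g b y := by
  intro k z h1 h2 h3
  have := h k z h1 h2 h3
  have e : ∀ u, z ++ b :: u = (z ++ [b]) ++ u := by simp
  rw [e] at this ⊢
  exact append_lt_of_le (by simp) hxy this

lemma Lex.high {g x : List Bool} {b : Bool} (h : Lex (g ++ b :: x)) : High g b x := by
  intro k z h1 h2 h3
  have hx : k ++ x <:+ g ++ b :: x := by
    obtain ⟨p, hp⟩ := h2
    exact ⟨p, by rw [← List.append_assoc, hp]; simp⟩
  have h4 := h.2 _ hx (by
    intro h5
    have := congrArg List.length h5
    rw [h1] at this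
    simp at this; omega)
  rw [h1, List.append_assoc, append_lt_iff_of_odd h3] at h4
  exact h4

/-- A suffix starting inside `g b` falls under `Lex.border`: either it is smaller whatever follows,
or it begins with an odd border of `g`, and cancelling that border leaves exactly the inequality of
`High`. -/
lemma Lex.extend {g x : List Bool} {b : Bool} (hg : Lex g)
    (h1 : ∀ v, v <:+ x → val v < val (g ++ b :: x)) (h2 : High g b x) : Lex (g ++ b :: x) := by
  refine ⟨by simp, fun v hv hne => ?_⟩
  have e : g ++ b :: x = (g ++ [b]) ++ x := by simp
  rw [e] at hv
  rcases suffix_append_cases hv with h3 | ⟨q, ⟨p, hp⟩, hq, rfl⟩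
  · exact h1 v h3
  · have hp0 : p ≠ [] := by
      rintro rfl
      apply hne
      rw [e, ← hp]; simp
    obtain ⟨q', c, rfl⟩ : ∃ q' c, q = q' ++ [c] :=
      ⟨q.dropLast, q.getLast hq, (List.dropLast_append_getLast hq).symm⟩
    rw [← List.append_assoc] at hp
    obtain ⟨hp1, hp2⟩ := List.append_inj' hp (by simp)
    simp at hp2
    subst hp2
    rcases hg.border hp0 hp1.symm c with ⟨⟨z, hz⟩, h4⟩ | h4
    · have h5 := h2 (q' ++ [c]) z hz.symm ⟨p, by rw [← hp1]; simp⟩ h4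
      have := (append_lt_iff_of_odd h4 x (z ++ c :: x)).2 h5
      rw [← List.append_assoc, hz] at this
      exact this
    · have := h4 x (c :: x)
      simpa using this

lemma ev_append (g x : List Bool) : ev g ++ x = g ++ par g :: x := by simp [ev]
lemma od_append (g x : List Bool) : od g ++ x = g ++ (!par g) :: x := by simp [od]

/-- The longest common prefix of two lexical words that differ after it is lexical. -/
lemma lex_of_common_prefix {g s t : List Bool} (hα : Lex (ev g ++ s)) (hγ : Lex (od g ++ t))
    (hg : g ≠ []) : Lex g := by
  refine ⟨hg, fun k hk hne => ?_⟩
  obtain ⟨p, hp⟩ := hk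
  have hp0 : p ≠ [] := by rintro rfl; exact hne (by simpa using hp)
  have a1 := hα.suffix_lt (p := p) (v := k ++ par g :: s) hp0
    (by rw [← List.append_assoc, hp, ev_append])
  have a2 := hγ.suffix_lt (p := p) (v := k ++ (!par g) :: t) hp0
    (by rw [← List.append_assoc, hp, od_append])
  have hlen : k.length < g.length := by
    have := List.length_pos_of_ne_nil hp0
    rw [← hp]; simp [this]
  by_contra hc
  rw [not_lt] at hc
  have hlt : val g < val k := lt_of_le_of_ne hc fun h => hne (val_injective h).symm
  by_cases hk : k <+: g
  · obtain ⟨r, hr⟩ := hk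
    rcases r with _ | ⟨d, r⟩
    · exact hne (by simpa using hr)
    · rw [← hr] at hlt
      have hd := eq_par_of_append_lt hlt
      have key : ∀ u, val (k ++ d :: u) < val k := fun u => by
        have := ev_append_lt k u
        rwa [ev_append, ← hd] at this
      have e1 : ev g ++ s = k ++ d :: (r ++ par g :: s) := by
        rw [ev_append, show k ++ d :: (r ++ par g :: s) = (k ++ d :: r) ++ par g :: s by simp, hr]
      have e2 : od g ++ t = k ++ d :: (r ++ (!par g) :: t) := by
        rw [od_append, show k ++ d :: (r ++ (!par g) :: t) = (k ++ d :: r) ++ (!par g) :: t by simp,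
          hr]
      rw [e1] at a1
      rw [e2] at a2
      have b1 := a1.trans (key _)
      have b2 := a2.trans (key _)
      -- Both neighbours force the letter after `k` to be `par k`, but these two letters are
      -- opposite.
      have c1 := eq_par_of_append_lt b1
      have c2 := eq_par_of_append_lt b2
      rw [← c1] at c2
      simp at c2
  · have := append_lt_append_of_not_prefix hlt
      (fun h' => absurd h'.length_le (by omega)) hk (par g :: s) (par g :: s)
    rw [ev_append] at a1
    linarith

/-- The easy half of the comparison between the two sides of a common prefix. -/
lemma lex_od_of_le {g s t : List Bool} (hg : Lex g) (hα : Lex (ev g ++ s))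
    (hγ : Lex (od g ++ t)) (h : val t ≤ val s) : Lex (od g ++ s) := by
  rw [od_append] at hγ ⊢
  refine hg.extend (fun v hv => ?_) (hγ.high.mono h)
  have h1 : val v < val (ev g ++ s) := hα.2 v (hv.trans (List.suffix_append _ _)) (by
    rintro rfl
    have := hv.length_le
    simp at this)
  have h2 := ev_append_lt g s
  have h3 := lt_od_append g s
  rw [od_append] at h3
  linarith

/-! ### Lexical words of prescribed order between two given ones -/

lemma exists_longest {P : List Bool → Prop} (N : ℕ) (hb : ∀ h, P h → h.length ≤ N)
    (hex : ∃ h, P h) : ∃ h, P h ∧ ∀ h', P h' → h'.length ≤ h.length := by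
  classical
  obtain ⟨h0, h0P⟩ := hex
  have h1 := Nat.findGreatest_spec (P := fun n => ∃ h, P h ∧ h.length = n) (hb h0 h0P)
    ⟨h0, h0P, rfl⟩
  obtain ⟨h, hP, hl⟩ := h1
  refine ⟨h, hP, fun h' hP' => ?_⟩
  rw [hl]
  exact Nat.le_findGreatest (hb h' hP') ⟨h', hP', rfl⟩

/-- Otherwise `z` would begin with `ev k`, and cancelling this even prefix would give a proper
suffix of `z` not below `z`. -/
lemma Lex.lt_ev_append {z k : List Bool} (hz : Lex z) (h : val z < val k) :
    val z < val (ev k ++ z) := by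
  by_contra hc
  rw [not_lt] at hc
  have h1 : k <+: z := prefix_of_between (p := k) (u := ev k ++ z)
    (by rw [ev_append]; exact List.prefix_append _ _) List.prefix_rfl hc h.le
  obtain ⟨a, rfl⟩ := exists_eq_ev_append h1 h
  rw [append_le_iff_of_even (par_ev k)] at hc
  have h2 := hz.suffix_lt (p := ev k) (by simp [ev]) rfl
  linarith

/-- A suffix of `w` above `w` would also be a suffix of `k`, and it would lie above `k` because `k`
begins with `w`. -/
lemma Lex.of_prefix_of_suffix {w k : List Bool} (hk : Lex k) (h1 : w <+: k) (h2 : w <:+ k)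
    (hne : w ≠ []) : Lex w := by
  refine ⟨hne, fun v hv hvw => ?_⟩
  have hlen : v.length < w.length :=
    lt_of_le_of_ne hv.length_le fun h => hvw (hv.eq_of_length h)
  have hlt : val v < val k := hk.2 v (hv.trans h2) (by
    rintro rfl
    exact absurd h1.length_le (by omega))
  by_contra hc
  rw [not_lt] at hc
  have hlt' : val w < val v := lt_of_le_of_ne hc fun h => hvw (val_injective h).symm
  obtain ⟨r, rfl⟩ := h1
  by_cases hp : v <+: w
  · obtain ⟨a, rfl⟩ := exists_eq_ev_append hp hlt'
    have := ev_append_lt v (a ++ r)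
    rw [List.append_assoc] at hlt
    linarith
  · have := append_lt_append_of_not_prefix hlt'
      (fun h' => absurd h'.length_le (by omega)) hp r []
    rw [List.append_nil] at this
    linarith

/-- If `z < k` are lexical, then `k_e z` is lexical, or the word `k` decomposes into two lexical
words between `z` and `k`. -/
lemma Lex.ev_append_or_split {z k : List Bool} (hz : Lex z) (hk : Lex k) (h : val z < val k) :
    Lex (ev k ++ z) ∨ ∃ x y, Lex x ∧ Lex y ∧ val z ≤ val x ∧ val x ≤ val y ∧ val y < val k ∧
      x.length + y.length + 1 = k.length := by
  by_cases hH : High k (par k) z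
  · left
    have h1 := hz.lt_ev_append h
    rw [ev_append] at h1 ⊢
    exact hk.extend (fun v hv => (hz.suffix_le hv).trans_lt h1) hH
  right
  -- The longest border violating `High` is taken; its maximality is what makes the complementary
  -- word `y` lexical.
  obtain ⟨hb, ⟨k5, hk5, hsuf, hpar, hviol⟩, hmax⟩ := exists_longest
    (P := fun b => ∃ k5, k = b ++ k5 ∧ b <:+ k ++ [par k] ∧ par b = true ∧
      val z ≤ val (k5 ++ par k :: z)) k.length
    (by rintro b ⟨k5, rfl, -⟩; simp)
    (by
      simp only [High, not_forall, not_lt] at hH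
      obtain ⟨b, k5, h1, h2, h3, h4⟩ := hH
      exact ⟨b, k5, h1, h2, h3, h4⟩)
  have hb0 : hb ≠ [] := by rintro rfl; simp at hpar
  obtain ⟨x, c, rfl⟩ : ∃ x c, hb = x ++ [c] :=
    ⟨hb.dropLast, hb.getLast hb0, (List.dropLast_append_getLast hb0).symm⟩
  obtain ⟨x', hx'⟩ := hsuf
  rw [← List.append_assoc] at hx'
  obtain ⟨hx1, hx2⟩ := List.append_inj' hx' (by simp)
  simp at hx2
  have hc : c = !par x := by
    revert hpar; simp; cases c <;> cases par x <;> simp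
  have hod : x ++ [c] = od x := by rw [od, hc]
  rw [hod] at hk5 hpar hmax
  rw [← hx2] at hviol hmax
  have hx'0 : x' ≠ [] := by
    rintro rfl
    have := congrArg List.length hx1
    rw [hk5] at this
    simp at this; omega
  obtain ⟨y, d, rfl⟩ : ∃ y d, x' = y ++ [d] :=
    ⟨x'.dropLast, x'.getLast hx'0, (List.dropLast_append_getLast hx'0).symm⟩
  have hpk : par k = c := hx2.symm
  have hd : d = !par y := by
    have h1 := congrArg par hx1
    rw [hpk, hc] at h1
    revert h1; simp; cases d <;> cases par x <;> cases par y <;> simp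
  have hody : y ++ [d] = od y := by rw [od, hd]
  rw [hody] at hx1
  have hyk : val y < val k := by rw [← hx1]; exact lt_od_append y x
  -- Two odd blocks make up `ev k`, so the orders of `x` and `y` add up to that of `k`.
  have hev : ev k = od y ++ od x := by
    rw [ev, hpk, ← hx1, ← hod]; simp
  have hevz : ev k ++ z = od x ++ (k5 ++ c :: z) := by
    rw [ev_append, hpk]
    conv_lhs => rw [hk5]
    simp
  have hv : val (ev k ++ z) ≤ val (od x ++ z) := by
    rw [hevz, append_le_iff_of_odd (par_od x)]
    exact hviol
  have hxk : x <+: k := by rw [hk5, od_append]; exact List.prefix_append _ _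
  have hxk' : x <:+ k := ⟨_, hx1⟩
  have hzx : val z ≤ val x := by
    by_contra hcon
    rw [not_le] at hcon
    have h1 : x <+: z := prefix_of_between List.prefix_rfl hxk hcon.le h.le
    obtain ⟨z', rfl⟩ := exists_eq_od_append h1 hcon
    have h2 := hz.suffix_lt (p := od x) (by simp [od]) rfl
    have h3 := (append_lt_iff_of_odd (par_od x) (od x ++ z') z').2 h2
    have h4 := hz.lt_ev_append h
    linarith
  have hx0 : x ≠ [] := by
    rintro rfl
    have := hz.half_lt
    simp at hzx
    linarith
  have hxL : Lex x := hk.of_prefix_of_suffix hxk hxk' hx0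
  have hxy : val x ≤ val y := by
    have p1 : od x <+: k := ⟨k5, hk5.symm⟩
    have p2 : od y <+: k := ⟨x, hx1⟩
    rcases lt_trichotomy x.length y.length with hl | hl | hl
    · have h1 : od x <+: y :=
        List.prefix_of_prefix_length_le p1 (List.IsPrefix.trans (show y <+: od y from ⟨_, rfl⟩) p2) (by simp; omega)
      obtain ⟨r, rfl⟩ := h1
      exact (lt_od_append x r).le
    · have h1 : od x = od y := by
        have := List.prefix_of_prefix_length_le p1 p2 (by simp [hl])
        exact this.eq_of_length (by simp [hl])
      have : x = y := (List.append_inj' h1 (by simp)).1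
      rw [this]
    · exfalso
      have h1 : od y <+: x :=
        List.prefix_of_prefix_length_le p2 hxk (by simp; omega)
      obtain ⟨q, hq⟩ := h1
      have h3 : par (q ++ [c]) = false := by
        have := congrArg par hod
        rw [← hq] at this
        simpa using this
      have h4 : k = (od y ++ od y) ++ q := by
        rw [← hx1]; conv_lhs => rw [← hq]
        simp
      have h5 : od y ++ (q ++ c :: k5) = od y ++ x := by
        rw [hx1, hk5, ← hod, ← hq]; simp
      have h6 : q ++ c :: k5 = x := List.append_cancel_left h5
      -- As `q c` is even, all words beginning with it must lie below `k`; but `k` itself begins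
      -- with `q c`.
      rcases hk.border (by simp [od]) h4 c with ⟨-, h7⟩ | h7
      · rw [h7] at h3; simp at h3
      · obtain ⟨r, hr⟩ := hxk
        have := h7 (k5 ++ r) []
        rw [show q ++ c :: (k5 ++ r) = (q ++ c :: k5) ++ r by simp, h6, hr] at this
        simp at this
  have hy0 : y ≠ [] := by
    rintro rfl
    have := hxL.half_lt
    simp at hxy
    linarith
  refine ⟨x, y, hxL, ⟨hy0, fun q hq hqy => ?_⟩, hzx, hxy, hyk, ?_⟩
  · have hlen : q.length < y.length :=
      lt_of_le_of_ne hq.length_le fun h => hqy (hq.eq_of_length h)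
    obtain ⟨p, hp⟩ := hq
    have hp0 : p ≠ [] := by rintro rfl; exact hqy (by simpa using hp)
    have hkd : k = y ++ d :: x := by rw [← hx1, ← hody]; simp
    have h1 : val (q ++ d :: x) < val k := hk.suffix_lt hp0 (by rw [hkd, ← hp]; simp)
    by_contra hcon
    rw [not_lt] at hcon
    have hlt : val y < val q := lt_of_le_of_ne hcon fun h => hqy (val_injective h).symm
    by_cases hpre : q <+: y
    · obtain ⟨r0, hr0⟩ := exists_eq_ev_append hpre hlt
      have hk1 : k = ev q ++ (r0 ++ d :: x) := by rw [hkd, hr0]; simp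
      have h2 : val k < val q := by rw [hk1]; exact ev_append_lt _ _
      have h3 : d = par q := eq_par_of_append_lt (h1.trans h2)
      have h4 : val x < val (r0 ++ d :: x) := by
        rw [hk1, h3, ← ev_append, append_lt_iff_of_even (par_ev q)] at h1
        rw [h3]; exact h1
      have h5 : val (r0 ++ d :: x) < val k := hk.suffix_lt (by simp [ev]) hk1
      have h6 : x <+: r0 ++ d :: x := prefix_of_between List.prefix_rfl hxk h4.le h5.le
      obtain ⟨r1, hr1⟩ := exists_eq_od_append h6 h4
      -- A suffix `q` of `y` above `y` yields the longer violating border `ev q ++ od x`.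
      have h7 := hmax (ev q ++ od x) ⟨r1, by rw [hk1, hr1]; simp, ⟨p, by
        rw [hkd, ← hp, h3, ← hod]; simp [ev]⟩, by simp, by
          rw [← append_le_iff_of_odd (par_od x), ← List.append_assoc, ← hr1]
          refine le_trans ?_ hv
          rcases hk.border (by simp [ev]) hk1 c with ⟨-, h8⟩ | h8
          · exfalso
            have := congrArg par hk1
            rw [hpk] at this
            revert this h8
            simp only [par_append, par_ev, par_cons, par_nil]
            cases c <;> cases par r0 <;> cases d <;> cases par x <;> simp
          · have := h8 z (c :: z)
            rw [ev_append, hpk]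
            exact this.le⟩
      simp [od, ev] at h7
      omega
    · have := append_lt_append_of_not_prefix hlt
        (fun h' => absurd h'.length_le (by omega)) hpre (d :: x) (d :: x)
      rw [← hkd] at this
      linarith
  · have := congrArg List.length hx1
    simp at this; omega

lemma finite_between (N : ℕ) (z k : List Bool) :
    {w : List Bool | w.length ≤ N ∧ val z ≤ val w ∧ val w ≤ val k}.Finite :=
  (List.finite_length_le Bool N).subset fun _ h => h.1

/-- The termination measure of the next proof: the count of words of bounded length in an interval
drops when the interval shrinks past one of them. -/
lemma ncard_between_lt {N : ℕ} {z k z' k' w : List Bool} (h1 : val z ≤ val z')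
    (h2 : val k' ≤ val k) (hw : w.length ≤ N ∧ val z ≤ val w ∧ val w ≤ val k)
    (hw' : ¬ (val z' ≤ val w ∧ val w ≤ val k')) :
    {w : List Bool | w.length ≤ N ∧ val z' ≤ val w ∧ val w ≤ val k'}.ncard <
      {w : List Bool | w.length ≤ N ∧ val z ≤ val w ∧ val w ≤ val k}.ncard := by
  refine Set.ncard_lt_ncard ⟨fun u hu => ⟨hu.1, h1.trans hu.2.1, hu.2.2.trans h2⟩, fun h => ?_⟩
    (finite_between N z k)
  exact hw' (h hw).2

/-- Between two lexical words there is a lexical word whose order divides a given positive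
combination of their orders. -/
lemma Lex.exists_between_dvd {z k : List Bool} (hz : Lex z) (hk : Lex k) (hzk : val z ≤ val k)
    {a b : ℕ} (ha : 0 < a) (hb : 0 < b) :
    ∃ w, Lex w ∧ val z ≤ val w ∧ val w ≤ val k ∧
      w.length + 1 ∣ a * (z.length + 1) + b * (k.length + 1) := by
  suffices H : ∀ N c, ∀ z k : List Bool, Lex z → Lex k → val z ≤ val k → ∀ a b, 0 < a → 0 < b →
      a * (z.length + 1) + b * (k.length + 1) ≤ N →
      {w : List Bool | w.length ≤ N ∧ val z ≤ val w ∧ val w ≤ val k}.ncard = c →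
      ∃ w, Lex w ∧ val z ≤ val w ∧ val w ≤ val k ∧
        w.length + 1 ∣ a * (z.length + 1) + b * (k.length + 1) from
    H _ _ z k hz hk hzk a b ha hb le_rfl rfl
  intro N c
  induction c using Nat.strong_induction_on with
  | _ c ih =>
  intro z k hz hk hzk a b ha hb hN hc
  subst hc
  rcases hzk.eq_or_lt with heq | hlt
  · obtain rfl := val_injective heq
    exact ⟨z, hz, le_rfl, le_rfl, dvd_add (dvd_mul_left _ _) (dvd_mul_left _ _)⟩
  have hsum : (z.length + 1) + (k.length + 1) ≤ N :=
    le_trans (add_le_add (Nat.le_mul_of_pos_left _ ha) (Nat.le_mul_of_pos_left _ hb)) hN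
  have hkN : k.length ≤ N ∧ val z ≤ val k ∧ val k ≤ val k := ⟨by omega, hzk, le_rfl⟩
  have hzN : z.length ≤ N ∧ val z ≤ val z ∧ val z ≤ val k := ⟨by omega, le_rfl, hzk⟩
  -- The case of both coefficients equal to 1, with `w` strictly below `k` so that later intervals
  -- shrink.
  obtain ⟨w, hw, hzw, hwk, q, hq⟩ : ∃ w, Lex w ∧ val z ≤ val w ∧ val w < val k ∧
      w.length + 1 ∣ (z.length + 1) + (k.length + 1) := by
    rcases hz.ev_append_or_split hk hlt with h | ⟨x, y, hx, hy, h1, h2, h3, h4⟩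
    · have h1 := ev_append_lt k z
      exact ⟨_, h, (hz.lt_ev_append hlt).le, h1, by simp; exact ⟨1, by omega⟩⟩
    · obtain ⟨w', hw', h5, h6, q, hq⟩ := ih _ (ncard_between_lt le_rfl (h2.trans h3.le) hkN
        (fun h => by linarith [h.2])) z x hz hx h1 1 1 one_pos one_pos (by omega) rfl
      have hqpos : 0 < q := by
        rcases Nat.eq_zero_or_pos q with rfl | h
        · simp at hq
        · exact h
      rw [mul_comm (w'.length + 1) q] at hq
      obtain ⟨w, hw, h7, h8, h9⟩ := ih _ (ncard_between_lt h5 h3.le hkN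
        (fun h => by linarith [h.2])) w' y hw' hy (h6.trans h2) q 1 hqpos one_pos
        (by rw [← hq]; omega) rfl
      refine ⟨w, hw, h5.trans h7, h8.trans_lt h3, ?_⟩
      rw [← hq] at h9
      convert h9 using 1
      omega
  have hqpos : 0 < q := by
    rcases Nat.eq_zero_or_pos q with rfl | h
    · simp at hq
    · exact h
  -- Subtractive Euclidean step: the common part of the two coefficients is absorbed into a multiple
  -- of the order of `w`, leaving a combination on a smaller interval.
  rcases lt_trichotomy a b with hab | rfl | hab
  · obtain ⟨c, rfl⟩ : ∃ c, b = a + c := ⟨b - a, by omega⟩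
    have key : a * (z.length + 1) + (a + c) * (k.length + 1) =
        a * q * (w.length + 1) + c * (k.length + 1) := by
      calc _ = a * ((z.length + 1) + (k.length + 1)) + c * (k.length + 1) := by ring
        _ = _ := by rw [hq]; ring
    rcases hzw.eq_or_lt with h | h
    · obtain rfl := val_injective h
      have : z.length + 1 ∣ k.length + 1 :=
        (Nat.dvd_add_right dvd_rfl).1 ⟨q, hq⟩
      exact ⟨z, hz, le_rfl, hzk, dvd_add (dvd_mul_left _ _) (this.mul_left _)⟩
    · obtain ⟨w', h1, h2, h3, h4⟩ := ih _ (ncard_between_lt hzw le_rfl hzN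
        (fun h' => by linarith [h'.1])) w k hw hk hwk.le (a * q) c (Nat.mul_pos ha hqpos)
        (by omega) (by rw [← key]; exact hN) rfl
      exact ⟨w', h1, hzw.trans h2, h3, by rw [key]; exact h4⟩
  · refine ⟨w, hw, hzw, hwk.le, ?_⟩
    rw [← mul_add, hq]
    exact (dvd_mul_right _ _).mul_left _
  · obtain ⟨c, rfl⟩ : ∃ c, a = b + c := ⟨a - b, by omega⟩
    have key : (b + c) * (z.length + 1) + b * (k.length + 1) =
        c * (z.length + 1) + b * q * (w.length + 1) := by
      calc _ = b * ((z.length + 1) + (k.length + 1)) + c * (z.length + 1) := by ring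
        _ = _ := by rw [hq]; ring
    obtain ⟨w', h1, h2, h3, h4⟩ := ih _ (ncard_between_lt le_rfl hwk.le hkN
        (fun h' => by linarith [h'.2])) z w hz hw hzw c (b * q)
        (by omega) (Nat.mul_pos hb hqpos) (by rw [← key]; exact hN) rfl
    exact ⟨w', h1, h2, h3.trans hwk.le, by rw [key]; exact h4⟩

/-! ### Periodic words, and lexical words above a given one -/

/-- The `j`-fold repetition of a word. -/
def rep (j : ℕ) (e : List Bool) : List Bool := (List.replicate j e).flatten

@[simp] lemma rep_zero (e : List Bool) : rep 0 e = [] := rfl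

lemma rep_succ (j : ℕ) (e : List Bool) : rep (j + 1) e = e ++ rep j e := by
  simp [rep, List.replicate_succ]

lemma append_rep (j : ℕ) (e : List Bool) : e ++ rep j e = rep j e ++ e := by
  induction j with
  | zero => simp
  | succ j ih => rw [rep_succ, List.append_assoc, ← ih]

lemma length_rep (j : ℕ) (e : List Bool) : (rep j e).length = j * e.length := by
  simp [rep]

lemma par_rep {e : List Bool} (he : par e = false) (j : ℕ) : par (rep j e) = false := by
  induction j with
  | zero => simp
  | succ j ih => simp [rep_succ, he, ih]

lemma le_rep_append {e v : List Bool} (he : par e = false) (h : val v ≤ val (e ++ v)) (j : ℕ) :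
    val v ≤ val (rep j e ++ v) := by
  induction j with
  | zero => simp
  | succ j ih =>
    rw [rep_succ, List.append_assoc]
    exact h.trans ((append_le_iff_of_even he _ _).2 ih)

/-- A word that is a prefix of its shift by `e` is periodic with period `e`. -/
lemma exists_eq_rep_append {e : List Bool} (he : e ≠ []) (y : List Bool) (h : y <+: e ++ y) :
    ∃ j y', y = rep j e ++ y' ∧ y' <+: e ∧ y' ≠ e := by
  induction hn : y.length using Nat.strong_induction_on generalizing y with
  | _ n ih =>
  by_cases hl : e.length ≤ y.length
  · have h1 : e <+: y := List.prefix_of_prefix_length_le (List.prefix_append _ _) h hl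
    obtain ⟨y1, rfl⟩ := h1
    have h2 : y1 <+: e ++ y1 := (List.prefix_append_right_inj _).1 h
    have := List.length_pos_of_ne_nil he
    obtain ⟨j, y', h3, h4, h5⟩ := ih y1.length (by rw [← hn]; simp; omega) y1 h2 rfl
    exact ⟨j + 1, y', by rw [rep_succ, List.append_assoc, ← h3], h4, h5⟩
  · refine ⟨0, y, by simp, List.prefix_of_prefix_length_le h (List.prefix_append _ _) (by omega), ?_⟩
    rintro rfl
    exact hl le_rfl

lemma exists_max_suffix (x : List Bool) :
    ∃ v, v <:+ x ∧ ∀ v', v' <:+ x → val v' ≤ val v := by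
  induction x with
  | nil => exact ⟨[], List.suffix_rfl, fun v' h => by rw [List.suffix_nil.1 h]⟩
  | cons b x ih =>
    obtain ⟨v, hv, hmax⟩ := ih
    by_cases h : val v ≤ val (b :: x)
    · refine ⟨b :: x, List.suffix_rfl, fun v' h' => ?_⟩
      rcases List.suffix_cons_iff.1 h' with rfl | h'
      · exact le_rfl
      · exact (hmax v' h').trans h
    · refine ⟨v, hv.trans (List.suffix_cons _ _), fun v' h' => ?_⟩
      rcases List.suffix_cons_iff.1 h' with rfl | h'
      · exact (not_le.1 h).le
      · exact hmax v' h'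

/-- Let `y` be an even word of period `ev g`. If `v` lies above `ev g ++ (y ++ v)`, then so does
`y ++ v`, at least weakly. -/
lemma Lex.ev_append_le_of_lt {g y v : List Bool} (hg : Lex g) (hy : y <+: ev g ++ y)
    (hpar : par y = false) (hv : val (ev g ++ (y ++ v)) < val v) :
    val (ev g ++ (y ++ v)) ≤ val (y ++ v) := by
  by_contra hc
  rw [not_le] at hc
  obtain ⟨j, y', rfl, ⟨y'', hy''⟩, hne⟩ := exists_eq_rep_append (e := ev g) (by simp [ev]) y hy
  have hpe := par_ev g
  have hpr := par_rep hpe j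
  by_cases h0 : y' = []
  · subst h0
    rw [List.append_nil, ← List.append_assoc, append_rep, List.append_assoc] at hc
    rw [append_lt_iff_of_even hpr] at hc
    have := le_rep_append hpe hc.le (j + 1)
    rw [rep_succ, List.append_assoc] at this
    rw [List.append_nil] at hv
    linarith
  · have hpy' : par y' = false := by simpa [hpr] using hpar
    have hy0 : y'' ≠ [] := by rintro rfl; simp at hy''; exact hne hy''
    obtain ⟨q, c, rfl⟩ : ∃ q c, y'' = q ++ [c] :=
      ⟨y''.dropLast, y''.getLast hy0, (List.dropLast_append_getLast hy0).symm⟩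
    rw [ev, ← List.append_assoc] at hy''
    obtain ⟨h1, h2⟩ := List.append_inj' hy'' rfl
    have hcp : c = par g := by simpa using h2
    subst h1
    have e1 : ev (y' ++ q) ++ (rep j (ev (y' ++ q)) ++ y' ++ v) =
        rep j (ev (y' ++ q)) ++ (y' ++ (q ++ c :: (y' ++ v))) := by
      calc _ = ev (y' ++ q) ++ rep j (ev (y' ++ q)) ++ (y' ++ v) := by simp
        _ = rep j (ev (y' ++ q)) ++ (ev (y' ++ q) ++ (y' ++ v)) := by
          rw [append_rep, List.append_assoc]
        _ = _ := by rw [hcp]; simp [ev]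
    have hc' := hc
    rw [e1, List.append_assoc, append_lt_iff_of_even hpr, append_lt_iff_of_even hpy'] at hc'
    rcases hg.border h0 rfl c with ⟨_, h4⟩ | h4
    · simp [hcp, hpy'] at h4
    · have h5 := h4 (y' ++ v) (par (y' ++ q) :: (rep j (ev (y' ++ q)) ++ y' ++ v))
      rw [← ev_append] at h5
      linarith

/-- Let `ev g ++ s` be lexical and let `s < x < ev g ++ x` with `x` not longer than `s`. Then there
is a lexical word above `ev g ++ s` whose order divides the order of `ev g ++ x`. -/
lemma Lex.exists_lt_dvd {g s : List Bool} (hg : Lex g) (hα : Lex (ev g ++ s)) :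
    ∀ x : List Bool, x.length ≤ s.length → val s < val x → val x < val (ev g ++ x) →
      ∃ z, Lex z ∧ val (ev g ++ s) < val z ∧ z.length + 1 ∣ (g.length + 1) + (x.length + 1) ∧
        (val z ≤ val (ev g ++ x) ∨ ∃ v, v <:+ x ∧ val z ≤ val v) := by
  intro x
  induction hn : x.length using Nat.strong_induction_on generalizing x with
  | _ n ih =>
  subst hn
  intro hlen hsx hxe
  have hpe := par_ev g
  have hαx : val (ev g ++ s) < val (ev g ++ x) := (append_lt_iff_of_even hpe _ _).2 hsx
  -- If the greatest suffix `v` stays below `ev g ++ x`, that word is lexical. Otherwise `v` is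
  -- lexical, `x = y X v`, and the shorter word `y` satisfies the hypotheses again.
  obtain ⟨v, hv, hmax⟩ := exists_max_suffix x
  rcases lt_trichotomy (val v) (val (ev g ++ x)) with hlt | heq | hgt
  · refine ⟨ev g ++ x, ?_, hαx, by simp; exact ⟨1, by omega⟩, Or.inl le_rfl⟩
    rw [ev_append] at hα hlt ⊢
    exact hg.extend (fun v' hv' => (hmax v' hv').trans_lt hlt) (hα.high.mono hsx.le)
  · have h1 := congrArg List.length (val_injective heq)
    have h2 := hv.length_le
    simp at h1; omega
  have hvα : val (ev g ++ s) < val v := hαx.trans hgt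
  have hvL : Lex v := by
    constructor
    · rintro rfl
      have := hα.half_lt
      simp at hvα; linarith
    · intro v' hv' hne
      exact lt_of_le_of_ne (hmax v' (hv'.trans hv)) fun h => hne (val_injective h)
  obtain ⟨y, hy⟩ := hv
  have hy0 : y ≠ [] := by
    rintro rfl
    rw [List.nil_append] at hy
    rw [hy] at hgt
    linarith
  obtain ⟨y, X, rfl⟩ : ∃ q c, y = q ++ [c] :=
    ⟨y.dropLast, y.getLast hy0, (List.dropLast_append_getLast hy0).symm⟩
  obtain rfl : x = y ++ X :: v := by rw [← hy]; simp
  have hlen' : (y ++ X :: v).length = y.length + v.length + 1 := by simp; omega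
  have h1 : val s < val y := by
    by_contra hc
    rw [not_lt] at hc
    rcases hc.eq_or_lt with hc | hc
    · have := congrArg List.length (val_injective hc); omega
    have hp : y <+: s := prefix_of_between List.prefix_rfl (List.prefix_append _ _) hc.le hsx.le
    obtain ⟨w, rfl⟩ := exists_eq_od_append hp hc
    rw [eq_not_par_of_lt_append (hc.trans hsx), ← od_append,
      append_lt_iff_of_odd (par_od y)] at hsx
    have := hα.suffix_lt (p := ev g ++ od y) (v := w) (by simp [ev]) (by simp)
    linarith
  have h2 : ∀ v', v' <:+ y → val v' ≤ val v := by
    rintro q ⟨p, rfl⟩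
    by_contra hc
    rw [not_le] at hc
    have h3 := hmax (q ++ X :: v) ⟨p, by simp⟩
    have h4 : q <+: v := prefix_of_between (List.prefix_append _ _) List.prefix_rfl h3 hc.le
    obtain ⟨v2, hv2⟩ := exists_eq_ev_append h4 hc
    rw [eq_par_of_append_lt (h3.trans_lt hc), ← ev_append] at h3
    conv_rhs at h3 => rw [hv2]
    rw [append_le_iff_of_even (par_ev q)] at h3
    have := hvL.suffix_lt (p := ev q) (v := v2) (by simp [ev]) hv2
    linarith
  have h3 : val (ev g ++ y) ≤ val v := by
    by_contra hc
    rw [not_le] at hc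
    rw [← List.append_assoc] at hgt
    have h4 : ev g ++ y <+: v :=
      prefix_of_between (List.prefix_append _ _) List.prefix_rfl hgt.le hc.le
    obtain ⟨w, hw⟩ := exists_eq_ev_append h4 hc
    rw [eq_par_of_append_lt (hgt.trans hc), ← ev_append] at hgt
    conv_rhs at hgt => rw [hw]
    rw [append_lt_iff_of_even (par_ev _)] at hgt
    have := hvL.suffix_lt (p := ev (ev g ++ y)) (v := w) (by simp [ev]) hw
    linarith
  have h4 : val y < val (ev g ++ y) := by
    by_contra hc
    rw [not_lt] at hc
    rcases hc.eq_or_lt with hc | hc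
    · have := congrArg List.length (val_injective hc)
      simp at this
    have hp : y <+: ev g ++ y := by
      by_contra hp
      have := append_lt_append_of_not_prefix hc
        (fun h => by have := h.length_le; simp at this) hp (X :: v) (X :: v)
      rw [List.append_assoc] at this
      linarith
    obtain ⟨r, hr⟩ := exists_eq_ev_append hp hc
    have e1 : ev g ++ (y ++ X :: v) = ev y ++ (r ++ X :: v) := by
      rw [← List.append_assoc, hr, List.append_assoc]
    have h5 := ev_append_lt y (r ++ X :: v)
    rw [← e1] at h5
    have hX := eq_par_of_append_lt (hxe.trans h5)
    rw [hX, ← ev_append] at hxe hgt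
    have hp2 : ev y <+: ev g ++ ev y :=
      List.prefix_of_prefix_length_le (l₃ := ev g ++ (ev y ++ v))
        (by rw [ev_append y v, ← hX, e1]; exact List.prefix_append _ _)
        (by rw [← List.append_assoc]; exact List.prefix_append _ _) (by simp)
    have := hg.ev_append_le_of_lt hp2 (par_ev y) hgt
    linarith
  obtain ⟨z, hz, hαz, hdvd, hle⟩ := ih y.length (by omega) y rfl (by omega) h1 h4
  have hzv : val z ≤ val v := by
    rcases hle with h | ⟨v', hv', h⟩
    · exact h.trans h3
    · exact h.trans (h2 v' hv')
  obtain ⟨q, hq⟩ := hdvd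
  have hqpos : 0 < q := by
    rcases Nat.eq_zero_or_pos q with rfl | h
    · simp at hq
    · exact h
  -- With weights `q` and 1 the combination is the sum of the orders of `g`, `y` and `v`, which is
  -- the order of `ev g ++ x`: the letter `X` supplies the extra one.
  obtain ⟨w, hw, hzw, hwv, hd⟩ := hz.exists_between_dvd hvL hzv hqpos one_pos
  refine ⟨w, hw, hαz.trans_le hzw, ?_, Or.inr ⟨v, ⟨y ++ [X], by simp⟩, hwv⟩⟩
  rw [mul_comm q, ← hq] at hd
  convert hd using 1
  rw [hlen']; ring

/-! ### Star products of words and renormalization -/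

/-- The star product of words: every letter `R` of `δ` is replaced by `od g`, every letter `L` by
`ev g`, and `g` is appended. -/
def sub (g : List Bool) : List Bool → List Bool
  | [] => g
  | true :: δ => od g ++ sub g δ
  | false :: δ => ev g ++ sub g δ

@[simp] lemma sub_nil (g : List Bool) : sub g [] = g := rfl
@[simp] lemma sub_true (g δ : List Bool) : sub g (true :: δ) = od g ++ sub g δ := rfl
@[simp] lemma sub_false (g δ : List Bool) : sub g (false :: δ) = ev g ++ sub g δ := rfl

lemma sub_cons (g δ : List Bool) (b : Bool) :
    sub g (b :: δ) = (g ++ [xor b (par g)]) ++ sub g δ := by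
  cases b <;> simp [ev, od]

lemma sub_append (g δ ε : List Bool) : ∃ u, sub g (δ ++ ε) = u ++ sub g ε := by
  induction δ with
  | nil => exact ⟨[], rfl⟩
  | cons b δ ih =>
    obtain ⟨u, hu⟩ := ih
    exact ⟨(g ++ [xor b (par g)]) ++ u, by simp [sub_cons, hu]⟩

lemma length_sub (g δ : List Bool) :
    (sub g δ).length + 1 = (g.length + 1) * (δ.length + 1) := by
  induction δ with
  | nil => simp
  | cons b δ ih =>
    rw [sub_cons]
    simp only [List.length_append, List.length_cons, List.length_nil]
    linarith

lemma prefix_sub (g δ : List Bool) : g <+: sub g δ := by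
  rcases δ with _ | ⟨b, δ⟩
  · exact List.prefix_rfl
  · rw [sub_cons, List.append_assoc]; exact List.prefix_append _ _

/-- Each letter becomes a block of the same parity, and the blocks of `L` and `R` lead below and
above `g`, the image of the empty word. -/
lemma sub_lt_sub {g δ ε : List Bool} (h : val δ < val ε) : val (sub g δ) < val (sub g ε) := by
  induction hn : δ.length + ε.length using Nat.strong_induction_on generalizing δ ε with
  | _ n ih =>
  subst hn
  rcases δ with _ | ⟨_ | _, δ⟩ <;> rcases ε with _ | ⟨_ | _, ε⟩
  · exact absurd h (lt_irrefl _)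
  · have := val_false_lt_half ε
    simp only [val_nil] at h; linarith
  · exact lt_od_append _ _
  · exact ev_append_lt _ _
  · rw [sub_false, sub_false, append_lt_iff_of_even (par_ev g)]
    exact ih (δ.length + ε.length) (by simp; omega) (by simp only [val_false] at h; linarith) rfl
  · exact (ev_append_lt _ _).trans (lt_od_append _ _)
  · have := half_lt_val_true δ
    simp only [val_nil] at h; linarith
  · have := half_lt_val_true δ
    have := val_false_lt_half ε
    linarith
  · rw [sub_true, sub_true, append_lt_iff_of_odd (par_od g)]
    exact ih (ε.length + δ.length) (by simp; omega) (by simp only [val_true] at h; linarith) rfl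

lemma sub_lt_sub_iff {g δ ε : List Bool} : val (sub g δ) < val (sub g ε) ↔ val δ < val ε := by
  refine ⟨fun h => ?_, sub_lt_sub⟩
  by_contra hc
  rcases (not_lt.1 hc).eq_or_lt with h1 | h1
  · rw [val_injective h1] at h
    exact lt_irrefl _ h
  · exact lt_asymm h (sub_lt_sub h1)

lemma suffix_sub_cases {g δ v : List Bool} (h : v <:+ sub g δ) :
    (∃ δ', δ' <:+ δ ∧ v = sub g δ') ∨ (v <:+ g ∧ v ≠ g) ∨
      ∃ p q b δ', p ≠ [] ∧ g = p ++ q ∧ v = q ++ b :: sub g δ' := by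
  induction δ with
  | nil =>
    by_cases hv : v = g
    · exact Or.inl ⟨[], List.suffix_rfl, hv⟩
    · exact Or.inr (Or.inl ⟨h, hv⟩)
  | cons b δ ih =>
    rw [sub_cons] at h
    rcases suffix_append_cases h with h | ⟨q, ⟨p, hp⟩, hq, rfl⟩
    · rcases ih h with ⟨δ', h1, h2⟩ | h1 | h1
      · exact Or.inl ⟨δ', h1.trans (List.suffix_cons _ _), h2⟩
      · exact Or.inr (Or.inl h1)
      · exact Or.inr (Or.inr h1)
    · obtain ⟨q, c, rfl⟩ : ∃ r c, q = r ++ [c] :=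
        ⟨q.dropLast, q.getLast hq, (List.dropLast_append_getLast hq).symm⟩
      rw [← List.append_assoc] at hp
      obtain ⟨h1, h2⟩ := List.append_inj' hp rfl
      by_cases hp0 : p = []
      · subst hp0
        refine Or.inl ⟨b :: δ, List.suffix_rfl, ?_⟩
        rw [sub_cons, ← h2, ← h1]; simp
      · exact Or.inr (Or.inr ⟨p, q, c, δ, hp0, h1.symm, by simp⟩)

/-- The star product of lexical words is lexical. -/
lemma Lex.sub {g δ : List Bool} (hg : Lex g) (hδ : Lex δ) : Lex (sub g δ) := by
  obtain ⟨ε, hε⟩ := hδ.exists_eq_cons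
  have hS : LexSeq.sub g δ = g ++ (!par g) :: LexSeq.sub g ε := by rw [hε, sub_true, od_append]
  have hgS : val g < val (LexSeq.sub g δ) := by rw [hε]; exact lt_od_append _ _
  refine ⟨by rw [hS]; simp, fun v hv hne => ?_⟩
  rcases suffix_sub_cases hv with ⟨δ', h1, rfl⟩ | ⟨h1, h2⟩ | ⟨p, q, b, δ', hp, h1, rfl⟩
  · exact sub_lt_sub (hδ.2 δ' h1 fun h => hne (by rw [h]))
  · exact (hg.2 v h1 h2).trans hgS
  · rcases hg.border hp h1 b with ⟨⟨z, hz⟩, h3⟩ | h3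
    · have e1 : q ++ b :: LexSeq.sub g δ' = (q ++ [b]) ++ LexSeq.sub g δ' := by simp
      have e2 : g ++ (!par g) :: LexSeq.sub g ε =
          (q ++ [b]) ++ (z ++ (!par g) :: LexSeq.sub g ε) := by
        rw [← List.append_assoc (q ++ [b]), hz]
      rw [hS, e1, e2, append_lt_iff_of_odd h3]
      obtain ⟨c, hc⟩ := prefix_sub g δ'
      rw [← hc]
      -- Here `z` has parity `!par g`, so `z` followed by that letter is even, which leaves only the
      -- strict alternative.
      rcases hg.border (p := q ++ [b]) (by simp) hz.symm (!par g) with ⟨_, h4⟩ | h4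
      · have := congrArg par hz
        rw [par_append, h3] at this
        rw [← this] at h4
        simp at h4
      · exact h4 _ _
    · rw [hS]; exact h3 _ _

/-- A lexical word above `g` in the renormalization window of `g` is a star product with `g`. -/
lemma Lex.exists_eq_sub {g t : List Bool} (hγ : Lex (od g ++ t))
    (ht : val (ev g ++ t) < val t) : ∃ δ, Lex δ ∧ od g ++ t = LexSeq.sub g δ := by
  have hgγ : g <+: od g ++ t := by rw [od_append]; exact List.prefix_append _ _
  have key : ∀ τ, τ <:+ od g ++ t → g <+: τ → val (ev g ++ τ) < val τ →
      ∃ δ, τ = LexSeq.sub g δ := by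
    intro τ
    induction hn : τ.length using Nat.strong_induction_on generalizing τ with
    | _ n ih =>
    subst hn
    rintro hs ⟨r, rfl⟩ hlt
    rcases r with _ | ⟨b, τ⟩
    · exact ⟨[], by simp⟩
    · have e : g ++ b :: τ = (g ++ [b]) ++ τ := by simp
      have hs' : τ <:+ od g ++ t := by
        rw [e] at hs
        exact (List.suffix_append _ _).trans hs
      -- The window condition passes to the remaining suffix. That suffix then lies between two
      -- words beginning with `g`, so another block can be peeled off.
      have h1 : val (ev g ++ τ) < val τ := by
        by_cases hb : b = par g
        · subst hb
          rw [← ev_append, append_lt_iff_of_even (par_ev g)] at hlt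
          exact hlt
        · have hb : b = !par g := by revert hb; cases b <;> cases par g <;> simp
          subst hb
          have h2 := hγ.suffix_le hs
          rw [← od_append, append_le_iff_of_odd (par_od g)] at h2
          exact append_lt_of_le (by simp [ev]) h2 ht
      have h2 : g <+: τ := prefix_of_between (u := ev g ++ τ)
        (by rw [ev_append]; exact List.prefix_append _ _) hgγ h1.le (hγ.suffix_le hs')
      obtain ⟨δ, rfl⟩ := ih τ.length (by simp; omega) τ rfl hs' h2 h1
      by_cases hb : b = par g
      · exact ⟨false :: δ, by rw [hb, sub_false, ev_append]⟩
      · have hb : b = !par g := by revert hb; cases b <;> cases par g <;> simp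
        exact ⟨true :: δ, by rw [hb, sub_true, od_append]⟩
  obtain ⟨δ, hδ⟩ := key _ List.suffix_rfl hgγ ((ev_append_lt _ _).trans (lt_od_append _ _))
  refine ⟨δ, ⟨?_, fun δ' ⟨ε, hε⟩ hne => ?_⟩, hδ⟩
  · rintro rfl
    have := congrArg List.length hδ
    simp at this; omega
  · rw [← sub_lt_sub_iff (g := g), ← hδ]
    obtain ⟨u, hu⟩ := sub_append g ε δ'
    refine hγ.2 _ ⟨u, by rw [hδ, ← hε, hu]⟩ fun h => hne ?_
    rw [hδ] at h
    by_contra hne'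
    rcases lt_or_gt_of_ne (fun h' => hne' (val_injective h')) with h3 | h3 <;>
      · have := sub_lt_sub (g := g) h3
        rw [h] at this
        exact lt_irrefl _ this

/-! ### Neighbouring lexical words -/

lemma lex_true_replicate (j : ℕ) : Lex (true :: List.replicate j false) := by
  refine ⟨by simp, fun v hv hne => ?_⟩
  have h1 := half_lt_val_true (List.replicate j false)
  rcases List.suffix_cons_iff.1 hv with h | h
  · exact absurd h hne
  · rcases v with _ | ⟨b, v⟩
    · simpa using h1
    · have : b = false := List.eq_of_mem_replicate (h.subset (by simp))
      subst this
      exact (val_false_lt_half v).trans h1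

lemma exists_lex_length {q : ℕ} (hq : 0 < q) : ∃ w, Lex w ∧ w.length = q :=
  ⟨true :: List.replicate (q - 1) false, lex_true_replicate _, by simp; omega⟩

/-- The lexical words `ev g ++ s` and `od g ++ t` are neighbours among the lexical words of
their length. -/
structure Neighbours (g s t : List Bool) : Prop where
  left : Lex (ev g ++ s)
  right : Lex (od g ++ t)
  length : s.length = t.length
  not_between : ∀ w, Lex w → w.length = g.length + 1 + s.length → val (ev g ++ s) < val w →
    ¬ val w < val (od g ++ t)

namespace Neighbours

variable {g s t : List Bool}

lemma lex_prefix (h : Neighbours g s t) : Lex g := by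
  refine lex_of_common_prefix h.left h.right ?_
  rintro rfl
  have := h.left.half_lt
  have := val_false_lt_half s
  simp only [ev, par_nil, List.nil_append, List.singleton_append] at *
  linarith

/-- No lexical word between `ev g ++ s` and `g` has an order dividing that of `ev g ++ s`. -/
lemma not_dvd (h : Neighbours g s t) {z : List Bool} (hz : Lex z) (hαz : val (ev g ++ s) < val z)
    (hzg : val z < val g) : ¬ z.length + 1 ∣ g.length + 1 + s.length + 1 := by
  rintro ⟨q, hq⟩
  have hγ := lt_od_append g t
  rcases Nat.lt_or_ge q 2 with h2 | h2
  · have hq1 : q = 1 := by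
      rcases Nat.lt_or_ge q 1 with h3 | h3
      · have : q = 0 := by omega
        subst this; simp at hq
      · omega
    subst hq1
    exact h.not_between z hz (by omega) hαz (hzg.trans hγ)
  -- The star product of `z` with a word of order `q` has the order of the neighbours. It exceeds
  -- `z`, but still begins with `ev g` and so stays below `g`.
  · obtain ⟨δ, hδ, hl⟩ := exists_lex_length (q := q - 1) (by omega)
    have hlen := length_sub z δ
    rw [hl, show q - 1 + 1 = q by omega, ← hq] at hlen
    have hgz : g <+: z := prefix_of_between (u := ev g ++ s)
      (by rw [ev_append]; exact List.prefix_append _ _) List.prefix_rfl hαz.le hzg.le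
    obtain ⟨r, rfl⟩ := exists_eq_ev_append hgz hzg
    obtain ⟨ε, rfl⟩ := hδ.exists_eq_cons
    refine h.not_between _ (hz.sub hδ) (by omega) (hαz.trans ?_) (lt_trans ?_ hγ)
    · exact lt_od_append _ _
    · obtain ⟨c, hc⟩ := prefix_sub (ev g ++ r) (true :: ε)
      rw [← hc, List.append_assoc]
      exact ev_append_lt _ _

/-- If the order of `g` does not divide that of `ev g ++ s`, the right neighbour of `ev g ++ s` is
its flip at `g`. -/
lemma eq_of_not_dvd (h : Neighbours g s t)
    (hd : ¬ g.length + 1 ∣ g.length + 1 + s.length + 1) : s = t := by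
  have hg := h.lex_prefix
  -- Otherwise `od g ++ u` would be a star product with `g`, and its order a multiple of that of
  -- `g`.
  have hsub : ∀ u, Lex (od g ++ u) → (od g ++ u).length + 1 ∣ g.length + 1 + s.length + 1 →
      val u < val (ev g ++ u) := by
    intro u hu hdvd
    rcases lt_trichotomy (val u) (val (ev g ++ u)) with h1 | h1 | h1
    · exact h1
    · have := congrArg List.length (val_injective h1)
      simp at this
    · obtain ⟨δ, _, hδ⟩ := hu.exists_eq_sub h1
      rw [hδ, length_sub] at hdvd
      exact absurd ((dvd_mul_right _ _).trans hdvd) hd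
  rcases lt_trichotomy (val s) (val t) with hst | hst | hst
  · exfalso
    -- Descent: from the least `od g ++ u` whose order divides that of the neighbours,
    -- `Lex.exists_lt_dvd` yields a smaller one or a forbidden word up to `g`.
    let S : Set (List Bool) := {u | Lex (od g ++ u) ∧ val (od g ++ u) ≤ val (od g ++ t) ∧
      (od g ++ u).length + 1 ∣ g.length + 1 + s.length + 1}
    have hfin : S.Finite := by
      refine (List.finite_length_le Bool s.length).subset fun u hu => ?_
      have := Nat.le_of_dvd (by omega) hu.2.2
      simp at this ⊢; omega
    have htS : t ∈ S := ⟨h.right, le_rfl, by simp [h.length]⟩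
    obtain ⟨u, ⟨hu1, hu2, hu3⟩, hmin⟩ := Set.exists_min_image S (fun u => val (od g ++ u)) hfin
      ⟨t, htS⟩
    have hsu : val s < val u := hst.trans_le ((append_le_iff_of_odd (par_od g) _ _).1 hu2)
    have hlen : u.length ≤ s.length := by
      have := Nat.le_of_dvd (by omega) hu3
      simp at this; omega
    obtain ⟨z, hz, hαz, hdvd, hle⟩ := hg.exists_lt_dvd h.left u hlen hsu (hsub u hu1 hu3)
    have hzw : val z < val (od g ++ u) := by
      rcases hle with h1 | ⟨v, ⟨p, hp⟩, h1⟩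
      · exact h1.trans_lt ((ev_append_lt _ _).trans (lt_od_append _ _))
      · refine h1.trans_lt (hu1.suffix_lt (p := od g ++ p) (by simp [od]) ?_)
        rw [List.append_assoc, hp]
    have hdvd' : z.length + 1 ∣ g.length + 1 + s.length + 1 := by
      refine hdvd.trans ?_
      have e : (od g ++ u).length + 1 = g.length + 1 + (u.length + 1) := by simp; omega
      rwa [e] at hu3
    rcases lt_trichotomy (val z) (val g) with h1 | h1 | h1
    · exact h.not_dvd hz hαz h1 hdvd'
    · rw [val_injective h1] at hdvd'
      exact hd hdvd'
    · have hp : g <+: z := prefix_of_between (w := od g ++ u) List.prefix_rfl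
        (by rw [od_append]; exact List.prefix_append _ _) h1.le hzw.le
      obtain ⟨r, rfl⟩ := exists_eq_od_append hp h1
      exact absurd (hmin r ⟨hz, hzw.le.trans hu2, hdvd'⟩) (not_le.2 hzw)
  · exact val_injective hst
  · exfalso
    refine h.not_between _ (lex_od_of_le hg h.left h.right hst.le) (by simp)
      ((ev_append_lt _ _).trans (lt_od_append _ _)) ?_
    rwa [append_lt_iff_of_odd (par_od g)]

/-- If the order of `g` divides that of `ev g ++ s`, with quotient `d`, the right neighbour of
`ev g ++ s` is the star product of `g` and the least lexical word of order `d`. -/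
lemma eq_sub (h : Neighbours g s t) {l : List Bool} (hl : Lex l)
    (hd : (g.length + 1) * (l.length + 1) = g.length + 1 + s.length + 1)
    (hmin : ∀ δ, Lex δ → δ.length = l.length → val l ≤ val δ) : od g ++ t = sub g l := by
  have hg := h.lex_prefix
  have h1 : val (od g ++ t) ≤ val (sub g l) := by
    refine not_lt.1 (h.not_between _ (hg.sub hl) ?_ ?_)
    · have := length_sub g l; omega
    · obtain ⟨ε, rfl⟩ := hl.exists_eq_cons
      exact (ev_append_lt _ _).trans (lt_od_append _ _)
  -- By `h1`, `t` is at least the tail of the star product; that tail satisfies the window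
  -- condition, which persists upwards.
  have h2 : val (ev g ++ t) < val t := by
    obtain ⟨ε, rfl⟩ := hl.exists_eq_cons
    rw [sub_true, append_le_iff_of_odd (par_od g)] at h1
    refine append_lt_of_le (by simp [ev]) h1 ?_
    rw [← sub_false, sub_lt_sub_iff, val_false]
    linarith [val_pos ε]
  obtain ⟨δ, hδ, hδt⟩ := h.right.exists_eq_sub h2
  have hlen : δ.length = l.length := by
    have h3 := length_sub g δ
    rw [← hδt] at h3
    have h4 : (g.length + 1) * (δ.length + 1) = (g.length + 1) * (l.length + 1) := by
      rw [hd, ← h3]; simp [h.length]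
    have := Nat.eq_of_mul_eq_mul_left (by omega) h4
    omega
  rw [hδt] at h1 ⊢
  rcases (hmin δ hδ hlen).eq_or_lt with h3 | h3
  · rw [val_injective h3]
  · have := sub_lt_sub (g := g) h3
    linarith

/-- No longer prefix of the left neighbour can be flipped to give a lexical word. -/
lemma not_lex_od (h : Neighbours g s t) {w u : List Bool} (hw : ev g ++ s = ev w ++ u)
    (hlen : g.length < w.length) : ¬ Lex (od w ++ u) := by
  intro hL
  have hp : ev g <+: w := by
    refine List.prefix_of_prefix_length_le (l₃ := ev g ++ s) (List.prefix_append _ _) ?_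
      (by simpa using hlen)
    rw [hw, ev_append]; exact List.prefix_append _ _
  obtain ⟨c, rfl⟩ := hp
  refine h.not_between _ hL ?_ ?_ ?_
  · have := congrArg List.length hw
    simp at this ⊢; omega
  · rw [hw]; exact (ev_append_lt _ _).trans (lt_od_append _ _)
  · rw [od_append, List.append_assoc]
    exact (ev_append_lt _ _).trans (lt_od_append _ _)

end Neighbours

/-! ### Lexicality of the flipped word -/

/-- The second letter must be `L`: for `R R u`, comparison with the suffixes `R u` and `u` would put
the value of `u` both above and below 2/3. -/
lemma Lex.three_quarters_lt {w : List Bool} (hw : Lex w) (h : 2 ≤ w.length) : 3 / 4 < val w := by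
  obtain ⟨u, rfl⟩ := hw.exists_eq_cons
  rcases u with _ | ⟨_ | _, u⟩
  · simp at h
  · simp; linarith [val_lt_one u]
  · exfalso
    have h1 := hw.suffix_lt (p := [true]) (v := true :: u) (by simp) rfl
    have h2 := hw.suffix_lt (p := [true, true]) (v := u) (by simp) rfl
    simp at h1 h2
    linarith

lemma exists_eq_replicate_append (s : List Bool) :
    ∃ j r, s = List.replicate j false ++ r ∧ (r = [] ∨ ∃ r', r = true :: r') := by
  induction s with
  | nil => exact ⟨0, [], rfl, Or.inl rfl⟩
  | cons b s ih =>
    obtain ⟨j, r, rfl, h⟩ := ih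
    cases b
    · exact ⟨j + 1, r, by simp [List.replicate_succ], h⟩
    · exact ⟨0, _, rfl, Or.inr ⟨_, rfl⟩⟩

/-- The letter after the flipped one is not `L`. -/
lemma Neighbours.ne_false_cons {g s t : List Bool} (h : Neighbours g s t) (s' : List Bool) :
    s ≠ false :: s' := by
  rintro rfl
  -- Changing the last `L` of the initial run in `s` to `R` gives a lexical word above the left
  -- neighbour and still below `g`.
  obtain ⟨j, r, hs', hr⟩ := exists_eq_replicate_append s'
  set a := List.replicate j false with ha
  have hpa : par a = false := by
    rw [ha]; clear * -
    induction j with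
    | zero => rfl
    | succ j ih => simpa [List.replicate_succ] using ih
  have hs : false :: s' = a ++ false :: r := by
    rw [hs', ← List.cons_append, ha, ← List.replicate_succ, List.replicate_succ']; simp
  have hlt : val (false :: s') < val (a ++ true :: r) := by
    rw [hs, append_lt_iff_of_even hpa]
    exact (val_false_lt_half r).trans (half_lt_val_true r)
  have hα := h.left
  have hg0 := List.length_pos_of_ne_nil h.lex_prefix.1
  have h34 := hα.three_quarters_lt (by simp; omega)
  have hαβ : val (ev g ++ false :: s') < val (ev g ++ (a ++ true :: r)) :=
    (append_lt_iff_of_even (par_ev g) _ _).2 hlt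
  refine h.not_between (ev g ++ (a ++ true :: r)) ?_ ?_ hαβ
    ((ev_append_lt _ _).trans (lt_od_append _ _))
  · rw [ev_append, ev_append] at hαβ
    rw [ev_append]
    refine h.lex_prefix.extend (fun v hv => lt_trans ?_ hαβ) ?_
    · rw [← ev_append]
      rcases suffix_append_cases hv with h1 | ⟨q, h1, h2, rfl⟩
      · rcases List.suffix_cons_iff.1 h1 with rfl | h1
        · rcases hr with rfl | ⟨r', rfl⟩
          · simp; linarith
          · have := val_lt_one r'
            simp only [val_true]; linarith
        · obtain ⟨p, hp⟩ := h1
          refine hα.suffix_lt (p := ev g ++ (a ++ false :: p)) (by simp) ?_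
          rw [hs, ← hp]; simp
      · rcases q with _ | ⟨b, q⟩
        · exact absurd rfl h2
        · have : b = false := List.eq_of_mem_replicate (h1.subset (by simp))
          subst this
          have := val_false_lt_half (q ++ true :: r)
          rw [List.cons_append]
          linarith
    · rw [ev_append] at hα
      exact hα.high.mono hlt.le
  · have := congrArg List.length hs
    simp at this ⊢; omega

/-- Two odd words cannot commute in the presence of such a word `s`. -/
lemma append_ne_append_of_odd {A B s : List Bool} (hA : par A = true) (hB : par B = true)
    (h1 : val (A ++ s) < val s) (h2 : val (B ++ s) < val s)
    (h3 : val s < val (A ++ (B ++ s))) : A ++ B ≠ B ++ A := by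
  intro hc
  have e : A ++ (B ++ s) = B ++ (A ++ s) := by
    rw [← List.append_assoc, hc, List.append_assoc]
  have ne : ∀ {w : List Bool}, par w = true → w ≠ [] := by
    rintro w hw rfl; simp at hw
  have a1 := val_append_sub A (B ++ s) s
  have b1 := val_append_sub B (A ++ s) s
  rw [← e] at b1
  have a2 := (abs_lt.1 (abs_slope_lt_one (ne hA))).1
  have b2 := (abs_lt.1 (abs_slope_lt_one (ne hB))).1
  -- Contraction gives `ABs < As + s - Bs` and, by commutation, `ABs < Bs + s - As`; adding them
  -- contradicts `h3`.
  nlinarith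

/-- Let `κ` be the odd word whose removal leaves the greatest suffix `ρ` of the lexical word `κ ρ`
with an odd complement. Then the suffixes of `od ρ` followed by `κ` without its last letter are at
most `κ ρ`. -/
lemma Lex.suffix_le_of_max {k ρ v : List Bool} (hg : Lex (od k ++ ρ))
    (hmax : ∀ κ' ρ', od k ++ ρ = κ' ++ ρ' → par κ' = true → val ρ' ≤ val ρ)
    (hv : v <:+ od ρ ++ k) : val v < val (od k ++ ρ) ∨ v = od k ++ ρ := by
  rcases suffix_append_cases hv with ⟨p, rfl⟩ | ⟨q, ⟨p, hp⟩, hq0, rfl⟩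
  · left
    by_contra hc
    have hlt : val (od (p ++ v) ++ ρ) < val v := by
      refine lt_of_le_of_ne (not_lt.1 hc) fun h => ?_
      have := congrArg List.length (val_injective h)
      simp at this; omega
    have e1 : od (p ++ v) ++ ρ = p ++ (v ++ (!par (p ++ v)) :: ρ) := by simp [od_append]
    have h1 : val (v ++ (!par (p ++ v)) :: ρ) ≤ val (od (p ++ v) ++ ρ) :=
      hg.suffix_le ⟨p, e1.symm⟩
    have h2 : v <+: od (p ++ v) ++ ρ :=
      prefix_of_between (List.prefix_append _ _) List.prefix_rfl h1 hlt.le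
    obtain ⟨a, ha⟩ := exists_eq_ev_append h2 hlt
    have hc := eq_par_of_append_lt (h1.trans_lt hlt)
    rw [hc, ← ev_append] at h1 e1
    have hp : par p = true := by
      have := congrArg par e1
      simp only [par_append, par_od, par_ev] at this
      revert this; cases par p <;> cases par ρ <;> simp
    have h3 : val (ev v ++ ρ) ≤ val ρ := hmax _ _ e1 hp
    have h4 : ev v <+: ρ := prefix_of_between (List.prefix_append _ _)
      (by rw [ha]; exact List.prefix_append _ _) h3 (hg.suffix_le (List.suffix_append _ _))
    obtain ⟨ρ', hρ'⟩ := h4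
    have h5 : val ρ' ≤ val ρ := hmax (od (p ++ v) ++ ev v) ρ'
      (by rw [List.append_assoc, hρ']) (by simp)
    rw [← hρ', append_le_iff_of_even (par_ev v), hρ'] at h3
    have := congrArg List.length (val_injective (le_antisymm h3 h5))
    rw [← hρ'] at this
    simp at this
  · obtain ⟨q, c, rfl⟩ : ∃ r c, q = r ++ [c] :=
      ⟨q.dropLast, q.getLast hq0, (List.dropLast_append_getLast hq0).symm⟩
    rw [od, ← List.append_assoc] at hp
    obtain ⟨rfl, h2⟩ := List.append_inj' hp rfl
    have hg' : od k ++ (p ++ q) = (od k ++ p) ++ q := by simp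
    rcases hg.border (by simp [od]) hg' c with ⟨⟨a, ha⟩, h4⟩ | h4
    · by_cases hc : val (q ++ [c] ++ k) < val (od k ++ (p ++ q))
      · exact Or.inl hc
      · right
        by_contra hne
        have hgt := lt_of_le_of_ne (not_lt.1 hc) fun h => hne (val_injective h).symm
        rw [← ha, append_lt_iff_of_odd h4] at hgt
        have h5 := hgt.trans_le (hmax _ _ ha.symm h4)
        have h6 := hg.suffix_le (List.suffix_append (od k) (p ++ q))
        have h7 : k <+: p ++ q := prefix_of_between List.prefix_rfl
          (by rw [od_append]; exact List.prefix_append _ _) h5.le h6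
        obtain ⟨ρ', hρ'⟩ := exists_eq_od_append h7 h5
        rw [hρ'] at h6 hg
        have h8 := (append_le_iff_of_odd (par_od k) _ _).1 h6
        have h9 : val (od k ++ ρ') < val ρ' := by
          refine lt_of_le_of_ne h8 fun h => ?_
          have := congrArg List.length (val_injective h)
          simp at this
        have h10 := append_append_lt_of_odd (par_od k) h9
        have h11 := hg.suffix_lt (p := od k ++ od k) (v := ρ') (by simp [od]) (by simp)
        linarith
    · have := h4 k []
      simp only [List.append_nil] at this
      left; simpa using this

/-- The flip of the left neighbour at the common prefix is lexical. -/
lemma Neighbours.lex_od_append {g s t : List Bool} (h : Neighbours g s t) : Lex (od g ++ s) := by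
  by_cases hd : g.length + 1 ∣ g.length + 1 + s.length + 1
  swap
  · rw [h.eq_of_not_dvd hd]; exact h.right
  have hg := h.lex_prefix
  have hα := h.left
  rw [od_append]
  refine hg.extend (fun v hv => ?_) ?_
  · rw [← od_append]
    have h1 := ev_append_lt g s
    have h2 := lt_od_append g s
    have h3 := hα.suffix_le (hv.trans (List.suffix_append _ _))
    linarith
  intro k' z' hgk _ hk'
  by_contra hc
  rw [not_lt] at hc
  have hsz : val s < val z' := by
    have : par z' = !par g := by rw [hgk]; simp [hk']
    rw [← this, ← ev_append] at hc
    exact hc.trans_lt (ev_append_lt _ _)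
  -- A violated border puts `s` below some suffix of `g` with odd complement, hence below the
  -- greatest such suffix `ρ`. Exchanging the two odd blocks of `ev g` then gives `x₀`.
  obtain ⟨ρ, ⟨κ, hgκ, hκ⟩, hmax⟩ := Set.exists_max_image
    {ρ | ∃ κ, g = κ ++ ρ ∧ par κ = true} val
    ((List.finite_length_le Bool g.length).subset (by
      rintro ρ ⟨κ, h1, -⟩; rw [h1]; simp)) ⟨z', k', hgk, hk'⟩
  have hmax' : ∀ κ' ρ', g = κ' ++ ρ' → par κ' = true → val ρ' ≤ val ρ :=
    fun κ' ρ' h1 h2 => hmax ρ' ⟨κ', h1, h2⟩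
  have hsρ : val s < val ρ := hsz.trans_le (hmax' _ _ hgk hk')
  have hκ0 : κ ≠ [] := by rintro rfl; simp at hκ
  obtain ⟨k, c, rfl⟩ : ∃ r c, κ = r ++ [c] :=
    ⟨κ.dropLast, κ.getLast hκ0, (List.dropLast_append_getLast hκ0).symm⟩
  have hkc : k ++ [c] = od k := by
    rw [od]; congr 2
    simp at hκ
    revert hκ; cases c <;> cases par k <;> simp
  rw [hkc] at hgκ
  set x₀ := od ρ ++ k with hx₀
  have hlen₀ : x₀.length = g.length := by rw [hgκ]; simp [hx₀]; omega
  have hsuf : ∀ v, v <:+ x₀ → val v < val g ∨ v = g := by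
    intro v hv
    rw [hgκ]
    refine Lex.suffix_le_of_max (hgκ ▸ hg) (fun κ' ρ' h1 h2 => hmax' κ' ρ' (hgκ.trans h1) h2) hv
  have hsα : val s < val (ev g ++ s) := hα.suffix_lt (p := ev g) (by simp [ev]) rfl
  by_cases hxg : x₀ = g
  · have e1 : ev g = od k ++ od ρ := by
      rw [ev, hgκ]; simp [od]
    have e2 : ev g = od ρ ++ od k := by
      rw [ev, ← hxg, hx₀]; simp [od]
    have h1 : val (od k ++ s) < val s := by
      rw [← append_lt_iff_of_odd (par_od ρ), ← List.append_assoc, ← e2]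
      exact hα.suffix_lt (p := od k) (by simp [od]) (by rw [e1]; simp)
    have h2 : val (od ρ ++ s) < val s := by
      rw [← append_lt_iff_of_odd (par_od k), ← List.append_assoc, ← e1]
      exact hα.suffix_lt (p := od ρ) (by simp [od]) (by rw [e2]; simp)
    refine append_ne_append_of_odd (par_od k) (par_od ρ) h1 h2 ?_ (e1.symm.trans e2)
    rw [← List.append_assoc, ← e1]
    exact hsα
  · have hx₀g : val x₀ < val g := (hsuf _ List.suffix_rfl).resolve_right hxg
    have hρx₀ : val ρ < val x₀ := lt_od_append _ _
    have hstep : val x₀ < val (ev g ++ x₀) := by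
      have h1 := append_lt_append_of_not_prefix hx₀g
        (fun h' => hxg (h'.eq_of_length hlen₀)) (fun h' => hxg (h'.eq_of_length hlen₀.symm).symm)
        [] (par g :: x₀)
      rwa [List.append_nil, ← ev_append] at h1
    -- Prefixing copies of `ev g` preserves the hypotheses of `Lex.exists_lt_dvd` and keeps every
    -- suffix below `g`, so the word obtained will be forbidden by `not_dvd`.
    have key : ∀ j, val ρ < val (rep j (ev g) ++ x₀) ∧
        val (rep j (ev g) ++ x₀) < val (ev g ++ (rep j (ev g) ++ x₀)) ∧
        ∀ v, v <:+ rep j (ev g) ++ x₀ → val v < val g := by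
      intro j
      induction j with
      | zero =>
        refine ⟨hρx₀, hstep, fun v hv => (hsuf v hv).resolve_right ?_⟩
        rintro rfl
        exact hxg (hv.eq_of_length hlen₀.symm).symm
      | succ j ih =>
        obtain ⟨h1, h2, h3⟩ := ih
        rw [rep_succ, List.append_assoc]
        refine ⟨h1.trans h2, (append_lt_iff_of_even (par_ev g) _ _).2 h2, fun v hv => ?_⟩
        rcases suffix_append_cases hv with h4 | ⟨q, ⟨p, hp⟩, hq, rfl⟩
        · exact h3 v h4
        · obtain ⟨q, c, rfl⟩ : ∃ r c, q = r ++ [c] :=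
            ⟨q.dropLast, q.getLast hq, (List.dropLast_append_getLast hq).symm⟩
          rw [ev, ← List.append_assoc] at hp
          obtain ⟨h5, h6⟩ := List.append_inj' hp rfl
          by_cases hp0 : p = []
          · subst hp0
            rw [h6, ← h5]
            exact ev_append_lt q _
          · rcases hg.border hp0 h5.symm c with ⟨⟨r, hr⟩, h7⟩ | h7
            · have h8 := (append_lt_iff_of_odd h7 _ _).2 ((hmax' _ _ hr.symm h7).trans_lt h1)
              rwa [hr] at h8
            · have := h7 (rep j (ev g) ++ x₀) []
              rw [List.append_nil] at this
              simpa using this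
    obtain ⟨d, hd⟩ := hd
    -- One block is the prefix `ev g` and one accounts for `x₀`, so `j` copies give a word exactly
    -- as long as `s`.
    obtain ⟨j, rfl⟩ : ∃ j, d = j + 2 := by
      refine ⟨d - 2, ?_⟩
      have : ¬ d < 2 := by
        intro h'
        have : (g.length + 1) * d ≤ (g.length + 1) * 1 := Nat.mul_le_mul_left _ (by omega)
        omega
      omega
    obtain ⟨h1, h2, h3⟩ := key j
    have hl : (rep j (ev g) ++ x₀).length = s.length := by
      rw [List.length_append, length_rep, hlen₀, length_ev]
      have : (g.length + 1) * (j + 2) = j * (g.length + 1) + 2 * (g.length + 1) := by ring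
      omega
    obtain ⟨z, hz, hαz, hdvd, hle⟩ := hg.exists_lt_dvd hα _ hl.le (hsρ.trans h1) h2
    refine h.not_dvd hz hαz ?_ (by rw [hl] at hdvd; exact hdvd)
    rcases hle with h4 | ⟨v, hv, h4⟩
    · exact h4.trans_lt (ev_append_lt _ _)
    · exact h4.trans_lt (h3 v hv)

/-! ### Translation between sequences and words -/

/-- The word `R L^{α₁ - 1} R L^{α₂ - 1} ⋯` of a sequence of positive integers. -/
def enc : List ℕ → List Bool
  | [] => []
  | a :: α => true :: (List.replicate (a - 1) false ++ enc α)

@[simp] lemma enc_nil : enc [] = [] := rfl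

lemma enc_cons (a : ℕ) (α : List ℕ) :
    enc (a :: α) = true :: (List.replicate (a - 1) false ++ enc α) := rfl

lemma enc_append (α β : List ℕ) : enc (α ++ β) = enc α ++ enc β := by
  induction α with
  | nil => rfl
  | cons a α ih => simp [enc_cons, ih]

lemma enc_eq_nil_or (α : List ℕ) : enc α = [] ∨ ∃ u, enc α = true :: u := by
  rcases α with _ | ⟨a, α⟩
  · exact Or.inl rfl
  · exact Or.inr ⟨_, rfl⟩

lemma enc_ne_nil {α : List ℕ} (h : α ≠ []) : enc α ≠ [] := by
  rcases α with _ | ⟨a, α⟩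
  · exact absurd rfl h
  · simp [enc_cons]

lemma half_le_val_enc (α : List ℕ) : 1 / 2 ≤ val (enc α) := by
  rcases enc_eq_nil_or α with h | ⟨u, h⟩ <;> rw [h]
  · exact le_rfl
  · exact (half_lt_val_true u).le

lemma length_enc {α : List ℕ} (h : ∀ a ∈ α, 0 < a) : (enc α).length = α.sum := by
  induction α with
  | nil => rfl
  | cons a α ih =>
    have := h a (by simp)
    simp [enc_cons, ih fun b hb => h b (by simp [hb])]
    omega

lemma par_replicate_false (j : ℕ) : par (List.replicate j false) = false := by
  induction j with
  | zero => rfl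
  | succ j ih => simpa [List.replicate_succ] using ih

lemma par_enc (α : List ℕ) : par (enc α) = decide (Odd α.length) := by
  induction α with
  | nil => simp
  | cons a α ih =>
    simp only [enc_cons, par_cons, par_append, par_replicate_false, ih, List.length_cons,
      Nat.odd_add_one]
    by_cases h : Odd α.length <;> simp [h]

/-- Where the shorter run ends, one tail has value at least 1/2 and the other begins with `L`; the
leading `R` reverses their order. -/
lemma cons_replicate_lt_of_lt {a b : ℕ} {x : List Bool} (ha : 0 < a) (hx : 1 / 2 ≤ val x)
    (y : List Bool) (h : a < b) :
    val (true :: (List.replicate (a - 1) false ++ x)) <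
      val (true :: (List.replicate (b - 1) false ++ y)) := by
  obtain ⟨c, rfl⟩ : ∃ c, b = a + c + 1 := ⟨b - a - 1, by omega⟩
  have e : List.replicate (a + c + 1 - 1) false =
      List.replicate (a - 1) false ++ false :: List.replicate c false := by
    rw [← List.replicate_succ, ← List.replicate_add]
    congr 1
    omega
  have : val (List.replicate (a - 1) false ++ (false :: List.replicate c false ++ y)) <
      val (List.replicate (a - 1) false ++ x) := by
    rw [append_lt_iff_of_even (par_replicate_false _)]
    exact (val_false_lt_half _).trans_le hx
  rw [val_true, val_true, e, List.append_assoc]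
  linarith

lemma cons_replicate_lt_iff {a b : ℕ} {x y : List Bool} (ha : 0 < a) (hb : 0 < b)
    (hx : 1 / 2 ≤ val x) (hy : 1 / 2 ≤ val y) :
    val (true :: (List.replicate (a - 1) false ++ x)) <
      val (true :: (List.replicate (b - 1) false ++ y)) ↔ a < b ∨ a = b ∧ val y < val x := by
  rcases lt_trichotomy a b with h | rfl | h
  · simp only [h, true_or, iff_true]
    exact cons_replicate_lt_of_lt ha hx y h
  · rw [← append_lt_iff_of_even (par_replicate_false (a - 1)) y x, val_true, val_true]
    simp only [lt_irrefl, false_or, true_and]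
    constructor <;> intro h <;> linarith
  · have := cons_replicate_lt_of_lt hb hy x h
    simp only [h.ne', not_lt_of_gt h, false_and, or_self, iff_false, not_lt]
    exact this.le

lemma enc_injective {α β : List ℕ} (hα : ∀ a ∈ α, 0 < a) (hβ : ∀ b ∈ β, 0 < b)
    (h : enc α = enc β) : α = β := by
  induction α generalizing β with
  | nil =>
    rcases β with _ | ⟨b, β⟩
    · rfl
    · simp [enc_cons] at h
  | cons a α ih =>
    rcases β with _ | ⟨b, β⟩
    · simp [enc_cons] at h
    · rw [enc_cons, enc_cons] at h
      have ha := hα a (by simp)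
      have hb := hβ b (by simp)
      have h1 : ¬ a < b := fun hlt => by
        have := cons_replicate_lt_of_lt ha (half_le_val_enc α) (enc β) hlt
        rw [h] at this
        exact lt_irrefl _ this
      have h2 : ¬ b < a := fun hlt => by
        have := cons_replicate_lt_of_lt hb (half_le_val_enc β) (enc α) hlt
        rw [h] at this
        exact lt_irrefl _ this
      obtain rfl : a = b := by omega
      have h3 := List.append_cancel_left (List.cons.inj h).2
      rw [ih (fun c hc => hα c (by simp [hc])) (fun c hc => hβ c (by simp [hc])) h3]

lemma exists_enc_eq (w : List Bool) (hw : w = [] ∨ ∃ u, w = true :: u) :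
    ∃ α, (∀ a ∈ α, 0 < a) ∧ enc α = w := by
  induction hn : w.length using Nat.strong_induction_on generalizing w with
  | _ n ih =>
  subst hn
  rcases hw with rfl | ⟨u, rfl⟩
  · exact ⟨[], by simp, rfl⟩
  · obtain ⟨j, r, rfl, hr⟩ := exists_eq_replicate_append u
    obtain ⟨α, hα, rfl⟩ := ih r.length (by simp) r hr rfl
    refine ⟨(j + 1) :: α, ?_, by simp [enc_cons]⟩
    simpa using hα

lemma Lex.exists_enc_eq {w : List Bool} (hw : Lex w) : ∃ α, IsPositive α ∧ enc α = w := by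
  obtain ⟨α, h1, h2⟩ := LexSeq.exists_enc_eq w (Or.inr hw.exists_eq_cons)
  refine ⟨α, ⟨?_, h1⟩, h2⟩
  rintro rfl
  exact hw.1 h2.symm

lemma alt_zero (α : List ℕ) : alt α 0 = (α.getD 0 0 : ℕ) := by simp [alt]

lemma alt_succ (α : List ℕ) (i : ℕ) : alt α (i + 1) = - alt α.tail i := by
  rcases α with _ | ⟨a, α⟩ <;> simp [alt, pow_succ]

/-- Removing the first entry negates the alternating sequence, which exchanges the two sides. -/
lemma seqLT_iff (α β : List ℕ) : SeqLT α β ↔ α.getD 0 0 < β.getD 0 0 ∨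
    α.getD 0 0 = β.getD 0 0 ∧ SeqLT β.tail α.tail := by
  constructor
  · rintro ⟨i, h1, h2⟩
    rcases i with _ | i
    · left
      rw [alt_zero, alt_zero] at h2
      omega
    · right
      have h0 := h1 0 (by omega)
      rw [alt_zero, alt_zero] at h0
      refine ⟨by omega, i, fun j hj => ?_, ?_⟩
      · have := h1 (j + 1) (by omega)
        rw [alt_succ, alt_succ] at this
        omega
      · rw [alt_succ, alt_succ] at h2
        omega
  · rintro (h | ⟨h, i, h1, h2⟩)
    · exact ⟨0, by simp, by rw [alt_zero, alt_zero]; omega⟩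
    · refine ⟨i + 1, fun j hj => ?_, by rw [alt_succ, alt_succ]; omega⟩
      rcases j with _ | j
      · rw [alt_zero, alt_zero]; omega
      · rw [alt_succ, alt_succ]
        have := h1 j (by omega)
        omega

/-- The order on sequences is the order of the values of their words. -/
lemma seqLT_iff_val {α β : List ℕ} (hα : ∀ a ∈ α, 0 < a) (hβ : ∀ b ∈ β, 0 < b) :
    SeqLT α β ↔ val (enc α) < val (enc β) := by
  induction hn : α.length + β.length using Nat.strong_induction_on generalizing α β with
  | _ n ih =>
  subst hn
  rcases α with _ | ⟨a, α⟩ <;> rcases β with _ | ⟨b, β⟩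
  · simp only [lt_irrefl, iff_false]
    rintro ⟨i, -, h⟩
    simp at h
  · rw [seqLT_iff]
    have hb := hβ b (by simp)
    have := half_lt_val_true (List.replicate (b - 1) false ++ enc β)
    simp only [enc_nil, val_nil, enc_cons, this, iff_true]
    left; simpa using hb
  · rw [seqLT_iff]
    have ha := hα a (by simp)
    have := half_lt_val_true (List.replicate (a - 1) false ++ enc α)
    simp only [enc_nil, val_nil, enc_cons, not_lt_of_gt this, iff_false]
    simp; omega
  · have hα' : ∀ c ∈ α, 0 < c := fun c hc => hα c (by simp [hc])
    have hβ' : ∀ c ∈ β, 0 < c := fun c hc => hβ c (by simp [hc])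
    rw [seqLT_iff, enc_cons, enc_cons, cons_replicate_lt_iff (hα a (by simp)) (hβ b (by simp))
      (half_le_val_enc α) (half_le_val_enc β)]
    simp only [List.tail_cons]
    rw [ih (β.length + α.length) (by simp; omega) hβ' hα' rfl]
    simp

lemma suffix_enc_cases {α : List ℕ} {v : List Bool} (h : v <:+ enc α) :
    (∃ β, β <:+ α ∧ v = enc β) ∨ ∃ u, v = false :: u := by
  induction α with
  | nil => exact Or.inl ⟨[], List.suffix_rfl, List.suffix_nil.1 h⟩
  | cons a α ih =>
    rw [enc_cons] at h
    rcases List.suffix_cons_iff.1 h with rfl | h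
    · exact Or.inl ⟨a :: α, List.suffix_rfl, rfl⟩
    · rcases suffix_append_cases h with h | ⟨q, h1, h2, rfl⟩
      · rcases ih h with ⟨β, h1, h2⟩ | h1
        · exact Or.inl ⟨β, h1.trans (List.suffix_cons _ _), h2⟩
        · exact Or.inr h1
      · right
        rcases q with _ | ⟨b, q⟩
        · exact absurd rfl h2
        · have : b = false := List.eq_of_mem_replicate (h1.subset (by simp))
          subst this
          exact ⟨_, rfl⟩

/-- The word has more suffixes than the sequence, but those beginning with `L` and the empty one
have value at most 1/2, so they impose nothing. -/
lemma isLexical_iff {α : List ℕ} (hα : IsPositive α) : IsLexical α ↔ Lex (enc α) := by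
  obtain ⟨hne, hpos⟩ := hα
  have hpos' : ∀ β, β <:+ α → ∀ b ∈ β, 0 < b := fun β hβ b hb => hpos b (hβ.subset hb)
  constructor
  · intro h
    have h12 : 1 / 2 < val (enc α) := by
      rcases α with _ | ⟨a, α⟩
      · exact absurd rfl hne
      · exact half_lt_val_true _
    refine ⟨enc_ne_nil hne, fun v hv hvne => ?_⟩
    rcases suffix_enc_cases hv with ⟨β, hβ, rfl⟩ | ⟨u, rfl⟩
    · rw [← seqLT_iff_val (hpos' β hβ) hpos]
      by_cases hβ0 : β = []
      · subst hβ0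
        rw [seqLT_iff_val (by simp) hpos]
        exact h12
      · have hlt : β.length < α.length :=
          lt_of_le_of_ne hβ.length_le fun h' => hvne (by rw [hβ.eq_of_length h'])
        have := List.length_pos_of_ne_nil hβ0
        rw [List.suffix_iff_eq_drop.1 hβ]
        exact h _ (by omega) (by omega)
    · exact (val_false_lt_half u).trans h12
  · intro h i h1 h2
    have hs : α.drop i <:+ α := List.drop_suffix _ _
    rw [seqLT_iff_val (hpos' _ hs) hpos]
    have hs' : enc (α.take i) ++ enc (α.drop i) = enc α := by
      rw [← enc_append, List.take_append_drop]
    refine h.suffix_lt (p := enc (α.take i)) (enc_ne_nil ?_) hs'.symm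
    intro h0
    have := congrArg List.length h0
    simp at this
    rcases this with h3 | h3
    · omega
    · exact hne h3

/-- The bound on `n` excludes `(0)`, which truncated subtraction would encode like `(1)`. -/
lemma mem_L_iff {n : ℕ} (hn : 2 ≤ n) {α : List ℕ} :
    α ∈ L n ↔ IsPositive α ∧ Lex (enc α) ∧ (enc α).length + 1 = n := by
  constructor
  · rintro ⟨h1 | rfl, h2, h3⟩
    · refine ⟨h1, (isLexical_iff h1).1 h2, ?_⟩
      rw [length_enc h1.2, ← h3, degree, add_comm]
    · simp [degree] at h3; omega
  · rintro ⟨h1, h2, h3⟩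
    refine ⟨Or.inl h1, (isLexical_iff h1).2 h2, ?_⟩
    rw [← h3, length_enc h1.2, degree, add_comm]

lemma Lex.mem_L {α : List ℕ} (hα : IsPositive α) (h : Lex (enc α)) :
    α ∈ L ((enc α).length + 1) := by
  have := List.length_pos_of_ne_nil h.1
  exact (mem_L_iff (by omega)).2 ⟨hα, h, rfl⟩

/-! ### Extensions, elementary operations and star products of sequences -/

lemma incrLast_append_singleton (α : List ℕ) (a : ℕ) : incrLast (α ++ [a]) = α ++ [a + 1] := by
  induction α with
  | nil => rfl
  | cons b α ih =>
    rcases α with _ | ⟨c, α⟩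
    · rfl
    · simp only [List.cons_append, incrLast] at ih ⊢
      rw [ih]

lemma exists_eq_append_singleton {f : List ℕ} (hf : f ≠ []) : ∃ α a, f = α ++ [a] :=
  ⟨f.dropLast, f.getLast hf, (List.dropLast_append_getLast hf).symm⟩

lemma enc_incrLast {f : List ℕ} (hf : IsPositive f) : enc (incrLast f) = enc f ++ [false] := by
  obtain ⟨α, a, rfl⟩ := exists_eq_append_singleton hf.1
  have ha := hf.2 a (by simp)
  obtain ⟨b, rfl⟩ : ∃ b, a = b + 1 := ⟨a - 1, by omega⟩
  rw [incrLast_append_singleton, enc_append, enc_append]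
  simp [enc_cons, List.replicate_succ']

lemma enc_append_one (f : List ℕ) : enc (f ++ [1]) = enc f ++ [true] := by
  rw [enc_append]; simp [enc_cons]

lemma enc_evenExt {f : List ℕ} (hf : IsPositive f) : enc (evenExt f) = ev (enc f) := by
  rw [evenExt, ev, par_enc]
  split_ifs with h
  · rw [enc_incrLast hf]; simp [Nat.not_odd_iff_even.2 h]
  · rw [enc_append_one]; simp [Nat.not_even_iff_odd.1 h]

lemma enc_oddExt {f : List ℕ} (hf : IsPositive f) : enc (oddExt f) = od (enc f) := by
  rw [oddExt, od, par_enc]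
  split_ifs with h
  · rw [enc_append_one]; simp [Nat.not_odd_iff_even.2 h]
  · rw [enc_incrLast hf]; simp [Nat.not_even_iff_odd.1 h]

lemma incrLast_pos {f : List ℕ} (hf : IsPositive f) : IsPositive (incrLast f) := by
  obtain ⟨α, a, rfl⟩ := exists_eq_append_singleton hf.1
  rw [incrLast_append_singleton]
  refine ⟨by simp, fun b hb => ?_⟩
  rcases List.mem_append.1 hb with h | h
  · exact hf.2 b (by simp [h])
  · simp at h; omega

lemma append_one_pos {f : List ℕ} (hf : IsPositive f) : IsPositive (f ++ [1]) := by
  refine ⟨by simp, fun b hb => ?_⟩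
  rcases List.mem_append.1 hb with h | h
  · exact hf.2 b h
  · simp at h; omega

lemma evenExt_pos {f : List ℕ} (hf : IsPositive f) : IsPositive (evenExt f) := by
  rw [evenExt]; split_ifs
  · exact incrLast_pos hf
  · exact append_one_pos hf

lemma oddExt_pos {f : List ℕ} (hf : IsPositive f) : IsPositive (oddExt f) := by
  rw [oddExt]; split_ifs
  · exact append_one_pos hf
  · exact incrLast_pos hf

lemma IsPositive.append {α β : List ℕ} (hα : IsPositive α) (hβ : ∀ b ∈ β, 0 < b) :
    IsPositive (α ++ β) := by
  refine ⟨by simp [hα.1], fun b hb => ?_⟩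
  rcases List.mem_append.1 hb with h | h
  · exact hα.2 b h
  · exact hβ b h

lemma even_length_evenExt (f : List ℕ) (hf : f ≠ []) : Even (evenExt f).length := by
  rw [evenExt]
  split_ifs with h
  · obtain ⟨α, a, rfl⟩ := exists_eq_append_singleton hf
    rw [incrLast_append_singleton]
    simpa using h
  · simp [Nat.even_add_one, h]

lemma wedge_append (a u v : List ℕ) : wedge (a ++ u) (a ++ v) = a ++ wedge u v := by
  induction a with
  | nil => rfl
  | cons x a ih => simp [wedge, ih]

/-- One extension raises the last entry of `f` and the other keeps it, so the minimum there is that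
entry. -/
lemma wedge_evenExt_oddExt {f : List ℕ} (hf : f ≠ []) (p : List ℕ) :
    wedge (evenExt f ++ p) (oddExt f ++ p) = f := by
  obtain ⟨α, a, rfl⟩ := exists_eq_append_singleton hf
  rw [evenExt, oddExt]
  split_ifs <;> rw [incrLast_append_singleton] <;>
    simp [wedge_append, wedge, -List.append_assoc, List.append_assoc α]

lemma elemOp_evenExt {f : List ℕ} (hf : IsPositive f) (p : List ℕ) :
    ElemOp (evenExt f ++ p) (evenExt f).length (oddExt f ++ p) := by
  have hev := even_length_evenExt f hf.1
  by_cases h : Even f.length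
  · obtain ⟨α, a, rfl⟩ := exists_eq_append_singleton hf.1
    have ha := hf.2 a (by simp)
    have he : evenExt (α ++ [a]) = α ++ [a + 1] := by
      rw [evenExt, if_pos h, incrLast_append_singleton]
    rw [he] at hev ⊢
    have e := ElemOp.split (α := α ++ [a + 1] ++ p) (i := (α ++ [a + 1]).length)
      (by simp) (by simp) (by simp; omega)
    convert e using 1
    rw [splitCell, if_pos hev]
    simp
  · have he : evenExt f = f ++ [1] := by rw [evenExt, if_neg h]
    rw [he] at hev ⊢
    have := List.length_pos_of_ne_nil hf.1
    have e := ElemOp.conj (α := f ++ [1] ++ p) (i := (f ++ [1]).length)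
      (by simp; omega) (by simp) (by simp)
    convert e using 1
    rw [conjCell, if_pos hev]
    simp

/-- For splitting, `f` is the left sequence with its tail lowered by 1; for conjugation, the left
sequence without its tail 1. Both operations thus flip a single letter of the word. -/
lemma ElemOp.exists_evenExt {α α' : List ℕ} {i : ℕ} (hα : IsPositive α) (hi : Even i)
    (h : ElemOp α i α') : ∃ f p, IsPositive f ∧ (∀ a ∈ p, 0 < a) ∧ α = evenExt f ++ p ∧
      α' = oddExt f ++ p ∧ i = (evenExt f).length := by
  rcases h with ⟨h1, h2, h3⟩ | ⟨h1, h2, h3⟩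
  · have hlt : i - 1 < α.length := by omega
    rw [List.getD_eq_getElem _ _ hlt] at h3
    have hlen : (α.take (i - 1) ++ [α[i - 1] - 1]).length = i := by simp; omega
    have he : evenExt (α.take (i - 1) ++ [α[i - 1] - 1]) = α.take i := by
      rw [evenExt, hlen, if_pos hi, incrLast_append_singleton]
      obtain ⟨j, rfl⟩ : ∃ j, i = j + 1 := ⟨i - 1, by omega⟩
      simp only [Nat.add_sub_cancel] at h3 ⊢
      rw [List.take_succ_eq_append_getElem (by omega), Nat.sub_add_cancel (by omega)]
    refine ⟨α.take (i - 1) ++ [α[i - 1] - 1], α.drop i, ⟨by simp, fun a ha => ?_⟩,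
      fun a ha => hα.2 a (List.mem_of_mem_drop ha), ?_, ?_, ?_⟩
    · rcases List.mem_append.1 ha with ha | ha
      · exact hα.2 a (List.mem_of_mem_take ha)
      · simp at ha; omega
    · rw [he, List.take_append_drop]
    · rw [splitCell, if_pos hi, List.getD_eq_getElem _ _ hlt]
    · rw [he]; simp [h2]
  · have hlt : i - 1 < α.length := by omega
    rw [List.getD_eq_getElem _ _ hlt] at h3
    have hlen : (α.take (i - 1)).length = i - 1 := by simp; omega
    have hodd : ¬ Even (i - 1) := by
      rw [← Nat.even_add_one, Nat.sub_add_cancel (by omega)]; exact hi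
    have he : evenExt (α.take (i - 1)) = α.take i := by
      rw [evenExt, hlen, if_neg hodd]
      obtain ⟨j, rfl⟩ : ∃ j, i = j + 1 := ⟨i - 1, by omega⟩
      simp only [Nat.add_sub_cancel] at h3 ⊢
      rw [List.take_succ_eq_append_getElem (by omega), h3]
    refine ⟨α.take (i - 1), α.drop i, ⟨?_, fun a ha => hα.2 a (List.mem_of_mem_take ha)⟩,
      fun a ha => hα.2 a (List.mem_of_mem_drop ha), ?_, ?_, ?_⟩
    · intro h0
      rw [h0] at hlen
      simp at hlen; omega
    · rw [he, List.take_append_drop]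
    · rw [conjCell, if_pos hi]
    · rw [he]; simp [h2]

lemma evenExt_injective {f f' : List ℕ} (hf : IsPositive f) (hf' : IsPositive f')
    (h : evenExt f = evenExt f') : f = f' := by
  have h1 := congrArg enc h
  rw [enc_evenExt hf, enc_evenExt hf', ev, ev] at h1
  exact enc_injective hf.2 hf'.2 (List.append_inj' h1 rfl).1

lemma sub_replicate_append (g δ : List Bool) (j : ℕ) :
    sub g (List.replicate j false ++ δ) = rep j (ev g) ++ sub g δ := by
  induction j with
  | zero => simp
  | succ j ih => simp [List.replicate_succ, rep_succ, ih]

lemma enc_flatten_replicate {f : List ℕ} (hf : IsPositive f) (j : ℕ) :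
    enc (List.replicate j (evenExt f)).flatten = rep j (ev (enc f)) := by
  induction j with
  | zero => simp
  | succ j ih => simp [List.replicate_succ, rep_succ, enc_append, ih, enc_evenExt hf]

lemma star_cons (f l : List ℕ) (b : ℕ) : star f (b :: l) =
    oddExt f ++ (List.replicate (b - 1) (evenExt f)).flatten ++ star f l := by
  simp [star]

/-- The star product of sequences is the star product of their words. -/
lemma enc_star {f : List ℕ} (hf : IsPositive f) (l : List ℕ) :
    enc (star f l) = sub (enc f) (enc l) := by
  induction l with
  | nil => simp [star]
  | cons b l ih =>
    rw [star_cons, enc_append, enc_append, ih, enc_oddExt hf, enc_flatten_replicate hf, enc_cons,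
      sub_true, sub_replicate_append, List.append_assoc]

lemma star_pos {f : List ℕ} (hf : IsPositive f) (l : List ℕ) : IsPositive (star f l) := by
  induction l with
  | nil => simpa [star] using hf
  | cons b l ih =>
    rw [star_cons, List.append_assoc]
    refine (oddExt_pos hf).append fun a ha => ?_
    rcases List.mem_append.1 ha with ha | ha
    · obtain ⟨l', hl', ha⟩ := List.mem_flatten.1 ha
      rw [List.eq_of_mem_replicate hl'] at ha
      exact (evenExt_pos hf).2 a ha
    · exact ih.2 a ha

/-! ### From sequences to neighbouring words, and the conclusion -/

/-- Two words of the same length part at a last common prefix. -/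
lemma exists_common_prefix {u v : List Bool} (hl : u.length = v.length) (h : val u < val v) :
    ∃ g s t, u = ev g ++ s ∧ v = od g ++ t := by
  have key : ∀ u v : List Bool, u.length = v.length → u ≠ v →
      ∃ g b s t, u = g ++ b :: s ∧ v = g ++ (!b) :: t := by
    intro u
    induction u with
    | nil =>
      intro v hl hne
      exact absurd (List.length_eq_zero_iff.1 hl.symm).symm hne
    | cons b u ih =>
      intro v hl hne
      rcases v with _ | ⟨c, v⟩
      · simp at hl
      · by_cases hbc : b = c
        · subst hbc
          obtain ⟨g, d, s, t, rfl, rfl⟩ := ih v (by simpa using hl) (fun h => hne (by rw [h]))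
          exact ⟨b :: g, d, s, t, rfl, rfl⟩
        · refine ⟨[], b, u, v, rfl, ?_⟩
          have : c = !b := by revert hbc; cases b <;> cases c <;> simp
          rw [this]; rfl
  obtain ⟨g, b, s, t, rfl, rfl⟩ := key u v hl (by rintro rfl; exact lt_irrefl _ h)
  by_cases hb : b = par g
  · subst hb
    exact ⟨g, s, t, (ev_append _ _).symm, (od_append _ _).symm⟩
  · have hb : b = !par g := by revert hb; cases b <;> cases par g <;> simp
    subst hb
    have h1 := lt_od_append g s
    have h2 := ev_append_lt g t
    rw [od_append] at h1
    rw [ev_append] at h2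
    simp only [Bool.not_not] at h
    linarith

/-- The right neighbour is the least of the finitely many lexical words of the same length above
`enc α`. -/
lemma exists_neighbours {n : ℕ} (hn : 2 ≤ n) {α : List ℕ} (hα : α ∈ L n)
    (hmax : ¬ IsMaximalIn (L n) α) : ∃ g s t, Neighbours g s t ∧ enc α = ev g ++ s := by
  obtain ⟨hp, hL, hlen⟩ := (mem_L_iff hn).1 hα
  obtain ⟨β, hβ, hne, hlt⟩ : ∃ β, β ∈ L n ∧ β ≠ α ∧ ¬ SeqLT β α := by
    by_contra hc
    push Not at hc
    refine hmax ⟨hα, fun β hβ => ?_⟩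
    by_cases h : β = α
    · exact Or.inl h
    · exact Or.inr (hc β hβ h)
  obtain ⟨hβp, hβL, hβlen⟩ := (mem_L_iff hn).1 hβ
  rw [seqLT_iff_val hβp.2 hp.2] at hlt
  have hlt' : val (enc α) < val (enc β) :=
    lt_of_le_of_ne (not_lt.1 hlt) fun h =>
      hne (enc_injective hp.2 hβp.2 (val_injective h)).symm
  obtain ⟨w, ⟨hw1, hw2, hw3⟩, hmin⟩ := Set.exists_min_image
    {w | Lex w ∧ w.length = (enc α).length ∧ val (enc α) < val w} val
    ((List.finite_length_le Bool (enc α).length).subset fun w hw => hw.2.1.le)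
    ⟨enc β, hβL, by omega, hlt'⟩
  obtain ⟨g, s, t, h1, rfl⟩ := exists_common_prefix hw2.symm hw3
  refine ⟨g, s, t, ⟨h1 ▸ hL, hw1, ?_, fun z hz hzl hαz hzw => ?_⟩, h1⟩
  · rw [h1] at hw2; simp at hw2; omega
  · rw [← h1] at hαz
    refine absurd (hmin z ⟨hz, ?_, hαz⟩) (not_le.2 hzw)
    rw [hzl, h1]; simp

lemma Neighbours.isAdjacentTo {n : ℕ} (hn : 2 ≤ n) {α β : List ℕ} {g s t : List Bool}
    (h : Neighbours g s t) (hα : α ∈ L n) (hαe : enc α = ev g ++ s) (hβ : IsPositive β)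
    (hβe : enc β = od g ++ t) : IsAdjacentTo (L n) α β := by
  obtain ⟨hp, hL, hlen⟩ := (mem_L_iff hn).1 hα
  have hβn : β ∈ L n := by
    refine (mem_L_iff hn).2 ⟨hβ, hβe ▸ h.right, ?_⟩
    rw [← hlen, hαe, hβe]; simp [h.length]
  refine ⟨hα, hβn, ?_, ?_⟩
  · rw [seqLT_iff_val hp.2 hβ.2, hαe, hβe]
    exact (ev_append_lt _ _).trans (lt_od_append _ _)
  · rintro ⟨γ, hγ, h1, h2⟩
    obtain ⟨hγp, hγL, hγlen⟩ := (mem_L_iff hn).1 hγ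
    rw [seqLT_iff_val hp.2 hγp.2, hαe] at h1
    rw [seqLT_iff_val hγp.2 hβ.2, hβe] at h2
    refine h.not_between _ hγL ?_ h1 h2
    rw [hαe] at hlen
    simp at hlen; omega

lemma exists_isLeastIn {d : ℕ} (hd : 2 ≤ d) : ∃ l, IsPositive l ∧ Lex (enc l) ∧
    (enc l).length + 1 = d ∧ IsLeastIn (L d) l ∧
    ∀ δ, Lex δ → δ.length = (enc l).length → val (enc l) ≤ val δ := by
  obtain ⟨w₀, hw₀, hl₀⟩ := exists_lex_length (q := d - 1) (by omega)
  obtain ⟨w, ⟨hw, hwl⟩, hmin⟩ := Set.exists_min_image {w | Lex w ∧ w.length = d - 1} val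
    ((List.finite_length_le Bool (d - 1)).subset fun w hw => hw.2.le) ⟨w₀, hw₀, hl₀⟩
  obtain ⟨l, hl, rfl⟩ := hw.exists_enc_eq
  refine ⟨l, hl, hw, by omega, ⟨(mem_L_iff hd).2 ⟨hl, hw, by omega⟩, fun β hβ => ?_⟩,
    fun δ h1 h2 => hmin δ ⟨h1, h2.trans hwl⟩⟩
  obtain ⟨h1, h2, h3⟩ := (mem_L_iff hd).1 hβ
  rw [seqLT_iff_val hl.2 h1.2]
  rcases (hmin (enc β) ⟨h2, by omega⟩).eq_or_lt with h | h
  · exact Or.inl (enc_injective h1.2 hl.2 (val_injective h.symm))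
  · exact Or.inr h

lemma isMaximalIn_L_one : IsMaximalIn (L 1) [0] ∧ ∀ α ∈ L 1, α = [0] := by
  have h : ∀ α ∈ L 1, α = [0] := by
    rintro α ⟨h1 | h1, -, h3⟩
    · have := length_enc h1.2
      have := List.length_pos_of_ne_nil (enc_ne_nil h1.1)
      simp only [degree] at h3
      omega
    · exact h1
  refine ⟨⟨⟨Or.inr rfl, fun i h1 h2 => ?_, by simp [degree]⟩, fun β hβ => Or.inl (h β hβ)⟩, h⟩
  simp at h2; omega

lemma two_le_of_not_isMaximalIn {n : ℕ} {α : List ℕ} (hα : α ∈ L n)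
    (hmax : ¬ IsMaximalIn (L n) α) : 2 ≤ n := by
  by_contra hc
  have h1 : 1 + degree α = n := hα.2.2
  have : n = 1 := by omega
  subst this
  rw [isMaximalIn_L_one.2 α hα] at hmax
  exact hmax isMaximalIn_L_one.1

/-- The longest lexical step flips the word at the prefix it shares with its right neighbour. -/
lemma Neighbours.isLongestLexicalStep {n : ℕ} (hn : 2 ≤ n) {f p : List ℕ} {t : List Bool}
    (hf : IsPositive f) (hp : ∀ a ∈ p, 0 < a) (h : Neighbours (enc f) (enc p) t)
    (hα : evenExt f ++ p ∈ L n) :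
    IsLongestLexicalStep n (evenExt f ++ p) (oddExt f ++ p) ∧
      ∀ α', IsLongestLexicalStep n (evenExt f ++ p) α' → α' = oddExt f ++ p := by
  obtain ⟨hαp, hαL, hαl⟩ := (mem_L_iff hn).1 hα
  have hβp : IsPositive (oddExt f ++ p) := (oddExt_pos hf).append hp
  have eα : enc (evenExt f ++ p) = ev (enc f) ++ enc p := by rw [enc_append, enc_evenExt hf]
  have eβ : enc (oddExt f ++ p) = od (enc f) ++ enc p := by rw [enc_append, enc_oddExt hf]
  have hgives : GivesLexicalSuccessor n (evenExt f ++ p) (evenExt f).length (oddExt f ++ p) := by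
    refine ⟨even_length_evenExt f hf.1, elemOp_evenExt hf p, ?_, ?_⟩
    · refine (mem_L_iff hn).2 ⟨hβp, eβ ▸ h.lex_od_append, ?_⟩
      rw [← hαl, eα, eβ]; simp
    · rw [seqLT_iff_val hαp.2 hβp.2, eα, eβ]
      exact (ev_append_lt _ _).trans (lt_od_append _ _)
  have hle : ∀ j β, GivesLexicalSuccessor n (evenExt f ++ p) j β → j ≤ (evenExt f).length := by
    rintro j β ⟨hj, hop, hβ, -⟩
    obtain ⟨f', p', hf', hp', h1, rfl, rfl⟩ := hop.exists_evenExt hαp hj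
    by_contra hc
    rw [not_le] at hc
    have hpre : evenExt f <+: evenExt f' :=
      List.prefix_of_prefix_length_le (List.prefix_append _ p)
        (by rw [h1]; exact List.prefix_append _ _) hc.le
    obtain ⟨r, hr⟩ := hpre
    have hr0 : r ≠ [] := by
      rintro rfl
      rw [← hr] at hc
      simp at hc
    have hlen := congrArg (fun l => (enc l).length) hr
    simp only [enc_append, enc_evenExt hf, enc_evenExt hf', List.length_append,
      length_ev] at hlen
    have := List.length_pos_of_ne_nil (enc_ne_nil hr0)
    -- An operation on a longer left sequence flips a letter further to the right, which
    -- `not_lex_od` excludes.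
    refine h.not_lex_od (w := enc f') (u := enc p') ?_ (by omega) ?_
    · rw [← eα, h1, enc_append, enc_evenExt hf']
    · have := ((mem_L_iff hn).1 hβ).2.1
      rwa [enc_append, enc_oddExt hf'] at this
  refine ⟨⟨_, hgives, hle⟩, ?_⟩
  rintro α' ⟨i, hi, hmaxi⟩
  have hi' : i = (evenExt f).length := le_antisymm (hle _ _ hi) (hmaxi _ _ hgives)
  obtain ⟨f', p', hf', hp', h1, rfl, h2⟩ := hi.2.1.exists_evenExt hαp hi.1
  obtain ⟨h3, rfl⟩ := List.append_inj h1 (hi'.symm.trans h2)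
  rw [evenExt_injective hf hf' h3]

end LexSeq

theorem mainTheorem1 (n : ℕ) (α : List ℕ) (hα : α ∈ LexSeq.L n)
    (hmax : ¬ LexSeq.IsMaximalIn (LexSeq.L n) α) :
    (∃ α', LexSeq.IsLongestLexicalStep n α α') ∧
    ∀ α', LexSeq.IsLongestLexicalStep n α α' →
      ∃ m, LexSeq.wedge α α' ∈ LexSeq.L m ∧
        ∀ d r : ℕ, n = m * d + r → r < m →
          (0 < r → LexSeq.IsAdjacentTo (LexSeq.L n) α α') ∧
          (r = 0 → ∃ l, LexSeq.IsLeastIn (LexSeq.L d) l ∧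
            LexSeq.IsAdjacentTo (LexSeq.L n) α (LexSeq.star (LexSeq.wedge α α') l)) := by
  open LexSeq in
  have hn := two_le_of_not_isMaximalIn hα hmax
  obtain ⟨g, s, t, h, hαe⟩ := exists_neighbours hn hα hmax
  obtain ⟨hαp, hαL, hαl⟩ := (mem_L_iff hn).1 hα
  obtain ⟨f, hf, rfl⟩ := h.lex_prefix.exists_enc_eq
  -- The remainder must begin at an entry boundary in order to be the word of a sequence.
  obtain ⟨p, hp, rfl⟩ : ∃ p, (∀ a ∈ p, 0 < a) ∧ enc p = s := by
    refine exists_enc_eq s ?_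
    rcases s with _ | ⟨_ | _, s⟩
    · exact Or.inl rfl
    · exact absurd rfl (h.ne_false_cons s)
    · exact Or.inr ⟨s, rfl⟩
  obtain rfl : α = evenExt f ++ p := by
    refine enc_injective hαp.2 ((evenExt_pos hf).append hp).2 ?_
    rw [hαe, enc_append, enc_evenExt hf]
  obtain ⟨h1, h2⟩ := h.isLongestLexicalStep hn hf hp hα
  refine ⟨⟨_, h1⟩, fun α' hα' => ?_⟩
  obtain rfl := h2 α' hα'
  have hlen : (enc f).length + 1 + (enc p).length + 1 = n := by
    rw [hαe] at hαl
    simpa using hαl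
  rw [wedge_evenExt_oddExt hf.1]
  refine ⟨_, h.lex_prefix.mem_L hf, fun d r hnd hr => ⟨fun hr0 => ?_, fun hr0 => ?_⟩⟩
  · have ht : enc p = t := h.eq_of_not_dvd fun hd => by
      rw [hlen, hnd, Nat.dvd_add_right (dvd_mul_right _ _)] at hd
      exact absurd (Nat.le_of_dvd hr0 hd) (by omega)
    refine h.isAdjacentTo hn hα hαe ((oddExt_pos hf).append hp) ?_
    rw [enc_append, enc_oddExt hf, ht]
  · subst hr0
    -- Since `g` is a proper prefix, `m < n`; so the exceptional set `L 1` never supplies the second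
    -- factor.
    have hd : 2 ≤ d := by
      by_contra hc
      have : ((enc f).length + 1) * d ≤ ((enc f).length + 1) * 1 :=
        Nat.mul_le_mul_left _ (by omega)
      omega
    obtain ⟨l, hl, hlL, hll, hleast, hmin⟩ := exists_isLeastIn hd
    refine ⟨l, hleast, h.isAdjacentTo hn hα hαe (star_pos hf l) ?_⟩
    rw [enc_star hf, h.eq_sub hlL (by rw [hll, hlen, hnd]; rfl) hmin]
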